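/- Let $\mathcal{C}$ be a triangulated category, $\mathcal{N}\subset\mathcal{C}$ a thick subcategory (a full triangulated subcategory closed under direct summands) and $\mathcal{C}/\mathcal{N}$ the Verdier quotient. A slicing $P$ of a triangulated category $\mathcal{D}$ is a family of strictly full additive subcategories $P(\phi)$, $\phi\in\mathbb{R}$, with $P(\phi+1)=P(\phi)[1]$, with $\mathrm{Hom}(c,c')=0$ for $c\in P(\phi)$, $c'\in P(\phi')$, $\phi>\phi'$, and such that every nonzero object $c$ has a Harder--Narasimhan filtration, i.e. a finite filtration $0=c_0\to c_1\to\cdots\to c_n=c$ whose successive cones are nonzero objects of $P(\phi_1),\dots,P(\phi_n)$ with $\phi_1>\cdots>\phi_n$; put $\phi_P^+(c)=\phi_1$ and $\phi_P^-(c)=\phi_n$. For an interval $I$ let $P(I)$ be the full subcategory of objects all of whose Harder--Narasimhan factors have phase in $I$. A quasi-abelian category is length if ascending and descending chains of strict subobjects of each object stabilise. The slicing $P$ is locally finite if for some $\eta>0$ the category $P(\phi-\eta,\phi+\eta)$ is quasi-abelian and length for every $\phi\in\mathbb{R}$. The distance of two slicings is $$d(P,Q)=\sup_{0\ne c\in\mathcal{D}}\max\{|\phi_P^-(c)-\phi_Q^-(c)|,\,|\phi_P^+(c)-\phi_Q^+(c)|\}\in[0,\infty].$$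 A slicing $P$ of $\mathcal{C}$ is compatible with a pair $(P_{\mathcal{N}},P_{\mathcal{C}/\mathcal{N}})$ of slicings of $\mathcal{N}$ and $\mathcal{C}/\mathcal{N}$ if there are inclusions of objects $P_{\mathcal{N}}(\phi)\subset P(\phi)\subset P_{\mathcal{C}/\mathcal{N}}(\phi)$ for all $\phi\in\mathbb{R}$. Proposition. (1) Let $(Q_{\mathcal{N}},Q_{\mathcal{C}/\mathcal{N}})$ be a pair of slicings of $\mathcal{N}$ and $\mathcal{C}/\mathcal{N}$. The following are equivalent: (i) there is a locally finite slicing $Q$ of $\mathcal{C}$ compatible with $(Q_{\mathcal{N}},Q_{\mathcal{C}/\mathcal{N}})$; (ii) there are a locally finite slicing $P$ of $\mathcal{C}$, a pair $(P_{\mathcal{N}},P_{\mathcal{C}/\mathcal{N}})$ of slicings compatible with $P$, and a real number $0<\epsilon<\tfrac12$ such that $P(\phi-2\epsilon,\phi+2\epsilon)$ is a length quasi-abelian category for each $\phi\in\mathbb{R}$, $d(P_{\mathcal{N}},Q_{\mathcal{N}})<\epsilon$ and $d(P_{\mathcal{C}/\mathcal{N}},Q_{\mathcal{C}/\mathcal{N}})<\epsilon$.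 (2) For each pair of slicings of $\mathcal{N}$ and $\mathcal{C}/\mathcal{N}$ there is at most one slicing of $\mathcal{C}$ compatible with it. (3) The set of pairs of slicings of $\mathcal{N}$ and $\mathcal{C}/\mathcal{N}$ for which (i) holds is open in the product of the spaces of slicings of $\mathcal{N}$ and of $\mathcal{C}/\mathcal{N}$, each with the topology defined by $d$. -/

import Mathlib

open CategoryTheory CategoryTheory.Limits CategoryTheory.Pretriangulated
open scoped ENNReal ZeroObject

namespace SlicingGlue

universe v u

section QuasiAbelian

/-- A morphism is strict if the canonical morphism from its coimage to its image is an
isomorphism. -/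
def IsStrictHom {A : Type u} [Category.{v} A] [HasZeroMorphisms A] [HasKernels A]
    [HasCokernels A] {X Y : A} (f : X ⟶ Y) : Prop :=
  IsIso (Abelian.coimageImageComparison f)

/-- Quasi-abelian categories: additive categories with kernels and cokernels in which strict
epimorphisms are stable under pullback and strict monomorphisms are stable under pushout. -/
class IsQuasiAbelian (A : Type u) [Category.{v} A] [Preadditive A] : Prop where
  [hasZeroObject : HasZeroObject A]
  [hasBinaryBiproducts : HasBinaryBiproducts A]
  [hasKernels : HasKernels A]
  [hasCokernels : HasCokernels A]
  strictEpi_of_isPullback : ∀ {W X Y Z : A} {p : W ⟶ X} {q : W ⟶ Y} {f : X ⟶ Z} {g : Y ⟶ Z},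
    IsPullback p q f g → Epi g → IsStrictHom g → Epi p ∧ IsStrictHom p
  strictMono_of_isPushout : ∀ {W X Y Z : A} {f : W ⟶ X} {g : W ⟶ Y} {i : X ⟶ Z} {j : Y ⟶ Z},
    IsPushout f g i j → Mono g → IsStrictHom g → Mono i ∧ IsStrictHom i

attribute [instance] IsQuasiAbelian.hasKernels IsQuasiAbelian.hasCokernels

/-- The ordered set of strict subobjects of an object of a quasi-abelian category. -/
abbrev StrictSubobject {A : Type u} [Category.{v} A] [Preadditive A] [IsQuasiAbelian A]
    (X : A) : Type (max u v) :=
  {S : Subobject X // IsStrictHom S.arrow}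

/-- Length quasi-abelian categories: quasi-abelian categories which are noetherian and artinian,
that is, all ascending and all descending chains of strict subobjects stabilise. -/
def IsLengthQuasiAbelian (A : Type u) [Category.{v} A] [Preadditive A] : Prop :=
  ∃ _ : IsQuasiAbelian A, ∀ X : A,
    WellFoundedGT (StrictSubobject X) ∧ WellFoundedLT (StrictSubobject X)

end QuasiAbelian

section Slicings

variable (C : Type u) [Category.{v} C] [HasZeroObject C] [HasShift C ℤ] [Preadditive C]
  [∀ n : ℤ, (shiftFunctor C n).Additive] [Pretriangulated C]

variable {C} in
/-- A Harder-Narasimhan filtration of `X`, with respect to a collection `P` of classes of objects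
indexed by phases: a finite sequence `0 = c₀ ⟶ c₁ ⟶ ⋯ ⟶ cₙ = X` whose successive cones are
nonzero objects of `P φ₁, …, P φₙ` with `φ₁ > ⋯ > φₙ`. -/
structure HNFiltration (P : ℝ → ObjectProperty C) (X : C) where
  /-- the number of factors -/
  n : ℕ
  /-- the objects of the filtration -/
  obj : Fin (n + 1) → C
  /-- the maps of the filtration -/
  map (i : Fin n) : obj i.castSucc ⟶ obj i.succ
  /-- the semistable factors -/
  factor : Fin n → C
  /-- the maps to the semistable factors -/
  toFactor (i : Fin n) : obj i.succ ⟶ factor i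
  /-- the connecting maps -/
  connecting (i : Fin n) : factor i ⟶ (obj i.castSucc)⟦(1 : ℤ)⟧
  distinguished (i : Fin n) : Triangle.mk (map i) (toFactor i) (connecting i) ∈ distTriang C
  /-- the phases of the semistable factors -/
  phase : Fin n → ℝ
  phase_strictAnti : StrictAnti phase
  factor_mem (i : Fin n) : P (phase i) (factor i)
  factor_nonzero (i : Fin n) : ¬ IsZero (factor i)
  isZero_zero : IsZero (obj 0)
  /-- the last object of the filtration is `X` -/
  lastIso : obj (Fin.last n) ≅ X

/-- A slicing of a triangulated category; `P.sem φ` is the (strictly full, additive) subcategory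
of semistable objects of phase `φ`. -/
@[ext]
structure Slicing where
  /-- the semistable objects of a given phase -/
  sem : ℝ → ObjectProperty C
  sem_of_iso (φ : ℝ) {X Y : C} (e : X ≅ Y) : sem φ X → sem φ Y
  sem_zero (φ : ℝ) : sem φ 0
  sem_biprod (φ : ℝ) {X Y : C} : sem φ X → sem φ Y → sem φ (X ⊞ Y)
  sem_shift (φ : ℝ) (X : C) : sem (φ + 1) (X⟦(1 : ℤ)⟧) ↔ sem φ X
  hom_eq_zero {φ ψ : ℝ} (h : ψ < φ) {X Y : C} (hX : sem φ X) (hY : sem ψ Y) (f : X ⟶ Y) : f = 0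
  exists_hn (X : C) (hX : ¬ IsZero X) : Nonempty (HNFiltration sem X)

namespace Slicing

variable {C}

/-- The full subcategory `P(I)` on the objects whose semistable factors have phases in `I`. -/
def interval (P : Slicing C) (I : Set ℝ) : ObjectProperty C :=
  fun X => ∃ F : HNFiltration P.sem X, ∀ i, F.phase i ∈ I

/-- The (finite) set of phases of the semistable factors of `X`. -/
def phases (P : Slicing C) (X : C) : Set ℝ :=
  {φ | ∃ (F : HNFiltration P.sem X) (i : Fin F.n), F.phase i = φ}

/-- The maximal phase `φ⁺(X)` of a nonzero object. -/
noncomputable def maxPhase (P : Slicing C) (X : C) : ℝ := sSup (P.phases X)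

/-- The minimal phase `φ⁻(X)` of a nonzero object. -/
noncomputable def minPhase (P : Slicing C) (X : C) : ℝ := sInf (P.phases X)

/-- The condition that `P(φ - η, φ + η)` is a length quasi-abelian category for each `φ`. -/
def HasLengthIntervals (P : Slicing C) (η : ℝ) : Prop :=
  ∀ φ : ℝ, IsLengthQuasiAbelian (P.interval (Set.Ioo (φ - η) (φ + η))).FullSubcategory

/-- Locally finite slicings. -/
def IsLocallyFinite (P : Slicing C) : Prop :=
  ∃ η : ℝ, 0 < η ∧ P.HasLengthIntervals η

/-- The (possibly infinite) distance `d(P, Q)`, the supremum over nonzero objects `X` of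
`max (|φ⁻_P(X) - φ⁻_Q(X)|) (|φ⁺_P(X) - φ⁺_Q(X)|)`. -/
noncomputable instance : EDist (Slicing C) where
  edist P Q := ⨆ (X : C) (_ : ¬ IsZero X), ENNReal.ofReal
    (max |P.minPhase X - Q.minPhase X| |P.maxPhase X - Q.maxPhase X|)

/-- The topology on slicings is the one defined by the distance `d`. -/
noncomputable instance : PseudoEMetricSpace (Slicing C) where
  edist_self P := by simp [edist]
  edist_comm P Q := by
    simp only [edist, abs_sub_comm]
  edist_triangle P Q R := by
    refine iSup₂_le fun X hX => ?_
    have h (S T : Slicing C) : ENNReal.ofReal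
        (max |S.minPhase X - T.minPhase X| |S.maxPhase X - T.maxPhase X|) ≤ edist S T :=
      le_iSup₂ (f := fun (X : C) (_ : ¬ IsZero X) => ENNReal.ofReal
        (max |S.minPhase X - T.minPhase X| |S.maxPhase X - T.maxPhase X|)) X hX
    refine le_trans ?_ (add_le_add (h P Q) (h Q R))
    rw [← ENNReal.ofReal_add (by positivity) (by positivity)]
    refine ENNReal.ofReal_le_ofReal (max_le ?_ ?_)
    · exact (abs_sub_le _ (Q.minPhase X) _).trans (add_le_add (le_max_left _ _) (le_max_left _ _))
    · exact (abs_sub_le _ (Q.maxPhase X) _).trans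
        (add_le_add (le_max_right _ _) (le_max_right _ _))

end Slicing

end Slicings

section Compatibility

variable {C : Type u} [Category.{v} C] [HasZeroObject C] [HasShift C ℤ] [Preadditive C]
  [∀ n : ℤ, (shiftFunctor C n).Additive] [Pretriangulated C] [IsTriangulated C]
  (N : ObjectProperty C) [N.IsTriangulated]

/-- The Verdier quotient `C/N`: the localization of `C` at the morphisms with cone in `N`. -/
abbrev VerdierQuotient : Type u := N.trW.Localization

variable {N}

/-- A slicing `P` of `C` is compatible with a pair of slicings of `N` and `C/N` if there are
inclusions of objects `P_N(φ) ⊆ P(φ) ⊆ P_{C/N}(φ)` for each `φ`. -/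
def IsCompatible (P : Slicing C) (PN : Slicing N.FullSubcategory)
    (PQ : Slicing (VerdierQuotient N)) : Prop :=
  ∀ φ : ℝ, (∀ X : N.FullSubcategory, PN.sem φ X → P.sem φ X.obj) ∧
    (∀ X : C, P.sem φ X → PQ.sem φ (N.trW.Q.obj X))

/-- The pairs of slicings of `N` and `C/N` that glue to a locally finite slicing of `C`. -/
def IsGluable (q : Slicing N.FullSubcategory × Slicing (VerdierQuotient N)) : Prop :=
  ∃ Q : Slicing C, IsCompatible Q q.1 q.2 ∧ Q.IsLocallyFinite

end Compatibility

end SlicingGlue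

/-! A slicing is determined by its torsion pairs (objects of phase > t, objects of phase ≤ t), and
torsion pairs can be glued along C → C/N. From (V, M) on N and (V', M') on C/N, let `glueUp` be the
objects with image in V' and no nonzero map to M, and `glueDn` those with image in M' and no nonzero
map from V. The two are orthogonal: a map between them dies in C/N, so it factors through some n in
N, and the torsion triangle of n shows that it vanishes (`IsGlueDatum.hom_eq_zero`).

The difficulty is to decompose every object. The nearby compatible slicing P sandwiches the glued
pair: P(≥ t+ε) ⊆ `glueUp` ⊆ P(> t-ε), and dually. Hence only objects E of P(t-ε, t+ε) need
decomposing. The torsion triangle of E in C/N lifts to a subobject of E in that category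
(`exists_sub`). A minimal such lift has no map to M (`exists_le`). A maximal one among those with
subobject in `glueUp` has a quotient with no map from V (`exists_ge`). Both exist by the chain
conditions.

The glued pairs form a real family of t-structures whose slabs of small width δ lie in P(t-ε,
t+δ+ε), so they inherit chain conditions. These give Harder-Narasimhan filtrations slab by slab
(`IsCutFamily.exists_hasHN`), hence a locally finite slicing. It is compatible with the given pair
because its torsion pairs are the glued ones.

For a slicing that is itself compatible with the pair, the sandwich collapses to an equality. Its
semistable objects are then described by the pair alone (`IsCompatible.sem_iff`), which is
uniqueness. Openness follows from (ii) ⇒ (i): a gluable pair, with its glued slicing as P, shows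
that the whole ε-ball around it is gluable. -/

namespace SlicingGlue

universe v u v' u'

/-! ### Exactness and octahedra for triangles with the connecting map forgotten. -/

section Triangles

variable {C : Type u} [Category.{v} C] [HasZeroObject C] [HasShift C ℤ] [Preadditive C]
  [∀ n : ℤ, (shiftFunctor C n).Additive] [Pretriangulated C]

/-- The composable pair `f`, `g` extends to a distinguished triangle. -/
def Tri {X Y Z : C} (f : X ⟶ Y) (g : Y ⟶ Z) : Prop :=
  ∃ h : Z ⟶ X⟦(1 : ℤ)⟧, Triangle.mk f g h ∈ distTriang C

lemma Tri.zero {X Y Z : C} {f : X ⟶ Y} {g : Y ⟶ Z} (T : Tri f g) : f ≫ g = 0 := by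
  obtain ⟨h, H⟩ := T
  exact comp_distTriang_mor_zero₁₂ _ H

lemma Tri.desc {X Y Z W : C} {f : X ⟶ Y} {g : Y ⟶ Z} (T : Tri f g) (k : Y ⟶ W)
    (hk : f ≫ k = 0) : ∃ l : Z ⟶ W, g ≫ l = k := by
  obtain ⟨h, H⟩ := T
  obtain ⟨l, hl⟩ := Triangle.yoneda_exact₂ _ H k hk
  exact ⟨l, hl.symm⟩

lemma Tri.lift {X Y Z W : C} {f : X ⟶ Y} {g : Y ⟶ Z} (T : Tri f g) (k : W ⟶ Y)
    (hk : k ≫ g = 0) : ∃ l : W ⟶ X, l ≫ f = k := by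
  obtain ⟨h, H⟩ := T
  obtain ⟨l, hl⟩ := Triangle.coyoneda_exact₂ _ H k hk
  exact ⟨l, hl.symm⟩

lemma Tri.rot {X Y Z : C} {f : X ⟶ Y} {g : Y ⟶ Z} (T : Tri f g) :
    ∃ h : Z ⟶ X⟦(1 : ℤ)⟧, Tri g h := by
  obtain ⟨h, H⟩ := T
  exact ⟨h, _, rot_of_distTriang _ H⟩

lemma Tri.invRot {X Y Z : C} {f : X ⟶ Y} {g : Y ⟶ Z} (T : Tri f g) :
    ∃ h : Z⟦(-1 : ℤ)⟧ ⟶ X, Tri h f := by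
  obtain ⟨h, H⟩ := T
  exact ⟨_, _, inv_rot_of_distTriang _ H⟩

lemma exists_cone {X Y : C} (f : X ⟶ Y) : ∃ (Z : C) (g : Y ⟶ Z), Tri f g := by
  obtain ⟨Z, g, h, H⟩ := distinguished_cocone_triangle f
  exact ⟨Z, g, h, H⟩

lemma exists_fiber {X Y : C} (f : X ⟶ Y) : ∃ (Z : C) (g : Z ⟶ X), Tri g f := by
  obtain ⟨Z, g, h, H⟩ := distinguished_cocone_triangle₁ f
  exact ⟨Z, g, h, H⟩

lemma Tri.of_isZero_right {X Y Z : C} (hZ : IsZero Z) (e : X ≅ Y) (g : Y ⟶ Z) : Tri e.hom g :=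
  ⟨0, (Triangle.distinguished_iff_of_isZero₃ _ hZ).2 (inferInstanceAs (IsIso e.hom))⟩

lemma Tri.of_isZero_left {X Y Z : C} (hX : IsZero X) (f : X ⟶ Y) (e : Y ≅ Z) : Tri f e.hom :=
  ⟨0, (Triangle.distinguished_iff_of_isZero₁ _ hX).2 (inferInstanceAs (IsIso e.hom))⟩

lemma Tri.isIso_of_isZero_right {X Y Z : C} {f : X ⟶ Y} {g : Y ⟶ Z} (T : Tri f g)
    (hZ : IsZero Z) : IsIso f := by
  obtain ⟨h, H⟩ := T
  exact (Triangle.isZero₃_iff_isIso₁ _ H).1 hZ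

lemma Tri.isIso_of_isZero_left {X Y Z : C} {f : X ⟶ Y} {g : Y ⟶ Z} (T : Tri f g)
    (hX : IsZero X) : IsIso g := by
  obtain ⟨h, H⟩ := T
  exact (Triangle.isZero₁_iff_isIso₂ _ H).1 hX

lemma Tri.iso_mid {X Y Y' Z : C} {f : X ⟶ Y} {g : Y ⟶ Z} (T : Tri f g) (e : Y ≅ Y') :
    Tri (f ≫ e.hom) (e.inv ≫ g) := by
  obtain ⟨h, H⟩ := T
  exact ⟨h, isomorphic_distinguished _ H _
    (Triangle.isoMk _ _ (Iso.refl _) e.symm (Iso.refl _)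
      (show (f ≫ e.hom) ≫ e.inv = 𝟙 X ≫ f by simp)
      (show (e.inv ≫ g) ≫ 𝟙 Z = e.inv ≫ g by simp)
      (show h ≫ (𝟙 X)⟦(1 : ℤ)⟧' = 𝟙 Z ≫ h by simp))⟩

lemma Tri.iso_right {X Y Z Z' : C} {f : X ⟶ Y} {g : Y ⟶ Z} (T : Tri f g) (e : Z ≅ Z') :
    Tri f (g ≫ e.hom) := by
  obtain ⟨h, H⟩ := T
  exact ⟨e.inv ≫ h, isomorphic_distinguished _ H _
    (Triangle.isoMk _ _ (Iso.refl _) (Iso.refl _) e.symm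
      (show f ≫ 𝟙 Y = 𝟙 X ≫ f by simp)
      (show (g ≫ e.hom) ≫ e.inv = 𝟙 Y ≫ g by simp)
      (show (e.inv ≫ h) ≫ (𝟙 X)⟦(1 : ℤ)⟧' = e.inv ≫ h by simp))⟩

lemma Tri.iso_left {X X' Y Z : C} {f : X ⟶ Y} {g : Y ⟶ Z} (T : Tri f g) (e : X' ≅ X) :
    Tri (e.hom ≫ f) g := by
  obtain ⟨h, H⟩ := T
  exact ⟨h ≫ e.inv⟦1⟧', isomorphic_distinguished _ H _
    (Triangle.isoMk _ _ e (Iso.refl _) (Iso.refl _)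
      (show (e.hom ≫ f) ≫ 𝟙 Y = e.hom ≫ f by simp)
      (show g ≫ 𝟙 Z = 𝟙 Y ≫ g by simp)
      (show (h ≫ e.inv⟦(1 : ℤ)⟧') ≫ e.hom⟦(1 : ℤ)⟧' = 𝟙 Z ≫ h by
        simp [← Functor.map_comp]))⟩

lemma Tri.map {D : Type u'} [Category.{v'} D] [HasZeroObject D] [HasShift D ℤ] [Preadditive D]
    [∀ n : ℤ, (shiftFunctor D n).Additive] [Pretriangulated D] (F : C ⥤ D) [F.CommShift ℤ]
    [F.IsTriangulated] {X Y Z : C} {f : X ⟶ Y} {g : Y ⟶ Z} (T : Tri f g) :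
    Tri (F.map f) (F.map g) := by
  obtain ⟨h, H⟩ := T
  exact ⟨_, F.map_distinguished _ H⟩

lemma Tri.exists_hom_of_zero {X Y Z : C} {f : X ⟶ Y} {g : Y ⟶ Z} (T : Tri f g) (hg : g = 0) :
    ∃ (h : Z ⟶ X⟦(1 : ℤ)⟧) (r : X⟦(1 : ℤ)⟧ ⟶ Z), h ≫ r = 𝟙 Z := by
  obtain ⟨h, T'⟩ := T.rot
  obtain ⟨r, hr⟩ := T'.desc (𝟙 Z) (by simp [hg])
  exact ⟨h, r, hr⟩

lemma Tri.exists_retract_mid {X Y Z : C} {f : X ⟶ Y} {g : Y ⟶ Z} (T : Tri f g) (hg : g = 0) :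
    ∃ s : Y ⟶ X, s ≫ f = 𝟙 Y :=
  T.lift (𝟙 Y) (by simp [hg])

lemma Tri.exists_section_mid {X Y Z : C} {f : X ⟶ Y} {g : Y ⟶ Z} (T : Tri f g) (hf : f = 0) :
    ∃ r : Z ⟶ Y, g ≫ r = 𝟙 Y :=
  T.desc (𝟙 Y) (by simp [hf])

lemma tri_biprod (X Y : C) : Tri (biprod.inl : X ⟶ X ⊞ Y) biprod.snd :=
  ⟨0, binaryBiproductTriangle_distinguished X Y⟩

/-- The octahedral axiom for the cones of a composition. -/
lemma Tri.octahedron [IsTriangulated C] {X Y Z A B D : C} {f : X ⟶ Y} {g : Y ⟶ Z}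
    {a : Y ⟶ A} {b : Z ⟶ B} {d : Z ⟶ D} (T : Tri f a) (T' : Tri g b) (T'' : Tri (f ≫ g) d) :
    ∃ (m : A ⟶ D) (n : D ⟶ B), Tri m n ∧ a ≫ m = g ≫ d ∧ d ≫ n = b := by
  obtain ⟨_, H⟩ := T
  obtain ⟨_, H'⟩ := T'
  obtain ⟨_, H''⟩ := T''
  let o := Triangulated.someOctahedron rfl H H' H''
  exact ⟨o.m₁, o.m₃, ⟨_, o.mem⟩, o.comm₁, o.comm₃⟩

/-- The octahedral axiom for the fibers of a composition. -/
lemma Tri.octahedron' [IsTriangulated C] {X Y Z A B D : C} {f : X ⟶ Y} {g : Y ⟶ Z}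
    {a : A ⟶ X} {b : B ⟶ Y} {d : D ⟶ X} (T : Tri a f) (T' : Tri b g) (T'' : Tri d (f ≫ g)) :
    ∃ (m : A ⟶ D) (n : D ⟶ B), Tri m n ∧ m ≫ d = a ∧ n ≫ b = d ≫ f := by
  obtain ⟨_, H⟩ := T
  obtain ⟨_, H'⟩ := T'
  obtain ⟨_, H''⟩ := T''
  let o := Triangulated.someOctahedron' rfl H H' H''
  exact ⟨o.m₁, o.m₃, ⟨_, o.mem⟩, o.comm₁, o.comm₄⟩

end Triangles

/-! ### Torsion pairs in a triangulated category. -/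

section Cuts

variable {C : Type u} [Category.{v} C] [HasZeroObject C] [HasShift C ℤ] [Preadditive C]
  [∀ n : ℤ, (shiftFunctor C n).Additive] [Pretriangulated C]

/-- A torsion pair in a triangulated category: `U` is left orthogonal to `L`, and each object is an
extension of an object of `L` by one of `U`. -/
structure IsCut (U L : ObjectProperty C) : Prop where
  hom_zero {X Y : C} (hX : U X) (hY : L Y) (f : X ⟶ Y) : f = 0
  up_retract {X Y : C} {i : X ⟶ Y} {r : Y ⟶ X} (h : i ≫ r = 𝟙 X) : U Y → U X
  dn_retract {X Y : C} {i : X ⟶ Y} {r : Y ⟶ X} (h : i ≫ r = 𝟙 X) : L Y → L X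
  exists_tri (X : C) : ∃ (A B : C) (f : A ⟶ X) (g : X ⟶ B), Tri f g ∧ U A ∧ L B

namespace IsCut

variable {U L U' L' : ObjectProperty C}

/-- If every map to `L` vanishes, the torsion triangle of `X` splits, so `X` is a retract of its
`U`-part. Each half of a torsion pair is thus the orthogonal of the other, which yields closure
under extensions and the reversal of inclusions. -/
lemma up_iff (c : IsCut U L) (X : C) : U X ↔ ∀ Y, L Y → ∀ f : X ⟶ Y, f = 0 := by
  refine ⟨fun hX Y hY f => c.hom_zero hX hY f, fun h => ?_⟩
  obtain ⟨A, B, f, g, T, hA, hB⟩ := c.exists_tri X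
  obtain ⟨s, hs⟩ := T.exists_retract_mid (h _ hB g)
  exact c.up_retract hs hA

lemma dn_iff (c : IsCut U L) (Y : C) : L Y ↔ ∀ X, U X → ∀ f : X ⟶ Y, f = 0 := by
  refine ⟨fun hY X hX f => c.hom_zero hX hY f, fun h => ?_⟩
  obtain ⟨A, B, f, g, T, hA, hB⟩ := c.exists_tri Y
  obtain ⟨s, hs⟩ := T.exists_section_mid (h _ hA f)
  exact c.dn_retract hs hB

lemma up_ext (c : IsCut U L) {X Y Z : C} {f : X ⟶ Y} {g : Y ⟶ Z} (T : Tri f g) (hX : U X)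
    (hZ : U Z) : U Y := by
  rw [c.up_iff]
  intro W hW k
  obtain ⟨l, hl⟩ := T.desc k (c.hom_zero hX hW _)
  rw [← hl, c.hom_zero hZ hW l, comp_zero]

lemma dn_ext (c : IsCut U L) {X Y Z : C} {f : X ⟶ Y} {g : Y ⟶ Z} (T : Tri f g) (hX : L X)
    (hZ : L Z) : L Y := by
  rw [c.dn_iff]
  intro W hW k
  obtain ⟨l, hl⟩ := T.lift k (c.hom_zero hW hZ _)
  rw [← hl, c.hom_zero hW hX l, zero_comp]

lemma up_iso (c : IsCut U L) {X Y : C} (e : X ≅ Y) (h : U X) : U Y :=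
  c.up_retract e.inv_hom_id h

lemma dn_iso (c : IsCut U L) {X Y : C} (e : X ≅ Y) (h : L X) : L Y :=
  c.dn_retract e.inv_hom_id h

lemma isZero (c : IsCut U L) {X : C} (h : U X) (h' : L X) : IsZero X :=
  (IsZero.iff_id_eq_zero X).2 (c.hom_zero h h' _)

lemma up_zero (c : IsCut U L) {X : C} (h : IsZero X) : U X :=
  (c.up_iff X).2 fun _ _ _ => h.eq_of_src _ _

lemma dn_zero (c : IsCut U L) {X : C} (h : IsZero X) : L X :=
  (c.dn_iff X).2 fun _ _ _ => h.eq_of_tgt _ _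

lemma up_biprod (c : IsCut U L) {X Y : C} (hX : U X) (hY : U Y) : U (X ⊞ Y) :=
  c.up_ext (tri_biprod X Y) hX hY

lemma dn_biprod (c : IsCut U L) {X Y : C} (hX : L X) (hY : L Y) : L (X ⊞ Y) :=
  c.dn_ext (tri_biprod X Y) hX hY

lemma le_iff (c : IsCut U L) (c' : IsCut U' L') : U ≤ U' ↔ L' ≤ L := by
  refine ⟨fun h Y hY => (c.dn_iff Y).2 fun X hX f => c'.hom_zero (h _ hX) hY f,
    fun h X hX => (c'.up_iff X).2 fun Y hY f => c.hom_zero hX (h _ hY) f⟩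

lemma dn_shift (c : IsCut U L) (c' : IsCut U' L') (hs : ∀ X, U X → U' (X⟦(1 : ℤ)⟧)) {X : C}
    (hX : L' X) : L (X⟦(-1 : ℤ)⟧) := by
  rw [c.dn_iff]
  intro Y hY f
  have h : f⟦(1 : ℤ)⟧' ≫ (shiftNegShift X (1 : ℤ)).hom = 0 := c'.hom_zero (hs _ hY) hX _
  rw [← cancel_mono (shiftNegShift X (1 : ℤ)).inv, Category.assoc, Iso.hom_inv_id,
    Category.comp_id, zero_comp] at h
  exact (shiftFunctor C (1 : ℤ)).map_injective (h.trans (Functor.map_zero _ _ _).symm)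

/-- Cones of morphisms between objects of `U` lie in `U`. -/
lemma up_cone (c : IsCut U L) {X Y Z : C} {f : X ⟶ Y} {g : Y ⟶ Z} (T : Tri f g) (hY : U Y)
    (hX : U (X⟦(1 : ℤ)⟧)) : U Z := by
  obtain ⟨h, T'⟩ := T.rot
  exact c.up_ext T' hY hX

lemma dn_fiber (c : IsCut U L) {X Y Z : C} {f : X ⟶ Y} {g : Y ⟶ Z} (T : Tri f g) (hY : L Y)
    (hZ : L (Z⟦(-1 : ℤ)⟧)) : L X := by
  obtain ⟨h, T'⟩ := T.invRot
  exact c.dn_ext T' hZ hY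

end IsCut

end Cuts

/-! ### Harder-Narasimhan filtrations as an inductive predicate. -/

section HasHN

variable {C : Type u} [Category.{v} C] [HasZeroObject C] [HasShift C ℤ] [Preadditive C]
  [∀ n : ℤ, (shiftFunctor C n).Additive] [Pretriangulated C] {P : ℝ → ObjectProperty C}

/-- `HasHN P l X` holds if `X` has a Harder-Narasimhan filtration whose phases are, in increasing
order, the elements of the list `l`. -/
inductive HasHN (P : ℝ → ObjectProperty C) : List ℝ → C → Prop
  | nil {X : C} (hX : IsZero X) : HasHN P [] X
  | cons {l : List ℝ} {X Y Z : C} {φ : ℝ} {f : X ⟶ Y} {g : Y ⟶ Z} (hX : HasHN P l X)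
      (T : Tri f g) (hZ : P φ Z) (hZ' : ¬ IsZero Z) (hl : ∀ ψ ∈ l, φ < ψ) : HasHN P (φ :: l) Y

lemma HasHN.iso {l : List ℝ} {X Y : C} (h : HasHN P l X) (e : X ≅ Y) : HasHN P l Y := by
  cases h with
  | nil hX => exact .nil (hX.of_iso e.symm)
  | cons hX T hZ hZ' hl => exact .cons hX (T.iso_mid e) hZ hZ' hl

lemma HasHN.singleton {X : C} {φ : ℝ} (h : P φ X) (hX : ¬ IsZero X) : HasHN P [φ] X :=
  .cons (.nil (isZero_zero C)) (Tri.of_isZero_left (isZero_zero C) 0 (Iso.refl X)) h hX (by simp)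

/-- Induction on the filtration of `Z`: the octahedron turns the fiber of `Y ⟶ Z ⟶ B`, with `B` the
last factor, into an extension of the previous stage of `Z` by `X`. -/
lemma HasHN.append [IsTriangulated C] {l l' : List ℝ} {X Y Z : C} {f : X ⟶ Y} {g : Y ⟶ Z}
    (hZ : HasHN P l' Z) (hX : HasHN P l X) (T : Tri f g) (h : ∀ ψ' ∈ l', ∀ ψ ∈ l, ψ' < ψ) :
    HasHN P (l' ++ l) Y := by
  induction hZ generalizing Y with
  | nil hZ =>
    have := T.isIso_of_isZero_right hZ
    exact hX.iso (asIso f)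
  | @cons l' Z' Z B φ a b hZ' T' hB hB' hl' ih =>
    obtain ⟨Y', d, T''⟩ := exists_fiber (g ≫ b)
    obtain ⟨m, n, TT, -, -⟩ := T.octahedron' T' T''
    refine .cons (ih TT fun ψ' hψ' ψ hψ => h ψ' (by simp [hψ']) ψ hψ) T'' hB hB' fun ψ hψ => ?_
    rcases List.mem_append.1 hψ with hψ | hψ
    · exact hl' ψ hψ
    · exact h φ (by simp) ψ hψ

lemma HasHN.exists_filtration {l : List ℝ} {X : C} (h : HasHN P l X) :
    ∃ F : HNFiltration P X, ∀ ψ, ψ ∈ l ↔ ∃ i, F.phase i = ψ := by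
  induction h with
  | @nil X hX =>
    exact ⟨{  n := 0
              obj := fun _ => X
              map := fun i => Fin.elim0 i
              factor := fun i => Fin.elim0 i
              toFactor := fun i => Fin.elim0 i
              connecting := fun i => Fin.elim0 i
              distinguished := fun i => Fin.elim0 i
              phase := Fin.elim0
              phase_strictAnti := fun i => Fin.elim0 i
              factor_mem := fun i => Fin.elim0 i
              factor_nonzero := fun i => Fin.elim0 i
              isZero_zero := hX
              lastIso := Iso.refl _ }, fun ψ => by simp⟩
  | @cons l X Y Z φ f g hX T hZ hZ' hl ih =>
    obtain ⟨F, hF⟩ := ih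
    let obj : Fin (F.n + 2) → C := Fin.snoc (α := fun _ => C) F.obj Y
    let ph : Fin (F.n + 1) → ℝ := Fin.snoc (α := fun _ => ℝ) F.phase φ
    -- Packing one step of the filtration into a proposition about its two ends and its phase lets
    -- the `Fin.snoc` equations be used by rewriting, without casts of morphisms.
    let R (A B : C) (t : ℝ) : Prop := ∃ (W : C) (m : A ⟶ B) (p : B ⟶ W) (q : W ⟶ A⟦(1 : ℤ)⟧),
      Triangle.mk m p q ∈ distTriang C ∧ P t W ∧ ¬ IsZero W
    have key (i : Fin (F.n + 1)) : R (obj i.castSucc) (obj i.succ) (ph i) := by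
      refine Fin.lastCases ?_ (fun j => ?_) i
      · have h₁ : obj (Fin.last F.n).castSucc = F.obj (Fin.last F.n) := Fin.snoc_castSucc ..
        have h₂ : obj (Fin.last F.n).succ = Y := Fin.snoc_last ..
        have h₃ : ph (Fin.last F.n) = φ := Fin.snoc_last ..
        rw [h₁, h₂, h₃]
        obtain ⟨q, H⟩ := T.iso_left F.lastIso
        exact ⟨Z, _, _, q, H, hZ, hZ'⟩
      · have h₁ : obj j.castSucc.castSucc = F.obj j.castSucc := Fin.snoc_castSucc ..
        have h₂ : obj j.castSucc.succ = F.obj j.succ := by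
          rw [Fin.succ_castSucc]; exact Fin.snoc_castSucc ..
        have h₃ : ph j.castSucc = F.phase j := Fin.snoc_castSucc ..
        rw [h₁, h₂, h₃]
        exact ⟨_, _, _, _, F.distinguished j, F.factor_mem j, F.factor_nonzero j⟩
    choose W m p q H hW hW' using key
    refine ⟨{ n := F.n + 1
              obj := obj
              map := m
              factor := W
              toFactor := p
              connecting := q
              distinguished := H
              phase := ph
              phase_strictAnti := ?_
              factor_mem := hW
              factor_nonzero := hW'
              isZero_zero := ?_
              lastIso := eqToIso (Fin.snoc_last ..) }, fun ψ => ?_⟩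
    · intro i j
      refine Fin.lastCases (fun h => absurd (Fin.le_last j) (not_le.2 h)) (fun i => ?_) i
      refine Fin.lastCases (fun _ => ?_) (fun j h => ?_) j
      · simp only [ph, Fin.snoc_last, Fin.snoc_castSucc]
        exact hl _ ((hF _).2 ⟨i, rfl⟩)
      · simp only [ph, Fin.snoc_castSucc]
        exact F.phase_strictAnti (by simpa using h)
    · have : obj 0 = F.obj 0 := Fin.snoc_castSucc (α := fun _ => C) Y F.obj 0
      rw [this]
      exact F.isZero_zero
    · rw [List.mem_cons, hF]
      constructor
      · rintro (rfl | ⟨i, rfl⟩)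
        · exact ⟨Fin.last _, Fin.snoc_last (α := fun _ => ℝ) ..⟩
        · exact ⟨i.castSucc, Fin.snoc_castSucc (α := fun _ => ℝ) ..⟩
      · rintro ⟨i, hi⟩
        revert hi
        refine Fin.lastCases (fun hi => ?_) (fun i hi => ?_) i
        · exact Or.inl (hi.symm.trans (Fin.snoc_last (α := fun _ => ℝ) ..))
        · exact Or.inr ⟨i, (Fin.snoc_castSucc (α := fun _ => ℝ) φ F.phase i).symm.trans hi⟩

lemma HNFiltration.hasHN {X : C} (F : HNFiltration P X) :
    ∃ l, HasHN P l X ∧ ∀ ψ, ψ ∈ l ↔ ∃ i, F.phase i = ψ := by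
  have key (k : ℕ) (hk : k < F.n + 1) : ∃ l, HasHN P l (F.obj ⟨k, hk⟩) ∧
      ∀ ψ, ψ ∈ l ↔ ∃ i : Fin F.n, i.val < k ∧ F.phase i = ψ := by
    induction k with
    | zero => exact ⟨[], .nil F.isZero_zero, by simp⟩
    | succ k ih =>
      obtain ⟨l, hl, hl'⟩ := ih (by omega)
      let i : Fin F.n := ⟨k, by omega⟩
      refine ⟨F.phase i :: l, .cons (f := F.map i) (g := F.toFactor i) hl
        ⟨_, F.distinguished i⟩ (F.factor_mem i) (F.factor_nonzero i) ?_, ?_⟩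
      · intro ψ hψ
        obtain ⟨j, hj, rfl⟩ := (hl' ψ).1 hψ
        exact F.phase_strictAnti hj
      · intro ψ
        rw [List.mem_cons, hl']
        constructor
        · rintro (rfl | ⟨j, hj, rfl⟩)
          · exact ⟨i, Nat.lt_succ_self k, rfl⟩
          · exact ⟨j, by omega, rfl⟩
        · rintro ⟨j, hj, rfl⟩
          rcases Nat.lt_succ_iff_lt_or_eq.1 hj with h | h
          · exact Or.inr ⟨j, h, rfl⟩
          · exact Or.inl (congrArg F.phase (Fin.ext h))
  obtain ⟨l, hl, hl'⟩ := key F.n (by omega)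
  refine ⟨l, hl.iso F.lastIso, fun ψ => (hl' ψ).trans ?_⟩
  exact exists_congr fun i => by simp

end HasHN

/-! ### The torsion pairs of a slicing, indexed by upper sets of phases. -/

section SlicingCuts

variable {C : Type u} [Category.{v} C] [HasZeroObject C] [HasShift C ℤ] [Preadditive C]
  [∀ n : ℤ, (shiftFunctor C n).Additive] [Pretriangulated C]

namespace Slicing

/-- The objects without nonzero maps to semistable objects with phase outside of `S`. If `S` is an
upper set, these are the objects whose semistable factors have phases in `S`. -/
def up (P : Slicing C) (S : Set ℝ) : ObjectProperty C :=
  fun X => ∀ ψ, ψ ∉ S → ∀ Y, P.sem ψ Y → ∀ f : X ⟶ Y, f = 0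

/-- The objects without nonzero maps from semistable objects with phase in `S`. If `S` is an
upper set, these are the objects whose semistable factors have phases outside of `S`. -/
def dn (P : Slicing C) (S : Set ℝ) : ObjectProperty C :=
  fun X => ∀ ψ, ψ ∈ S → ∀ Y, P.sem ψ Y → ∀ f : Y ⟶ X, f = 0

variable (P : Slicing C)

lemma up_of_sem {S : Set ℝ} (hS : IsUpperSet S) {φ : ℝ} (hφ : φ ∈ S) {X : C} (h : P.sem φ X) :
    P.up S X := fun _ hψ _ hY f =>
  P.hom_eq_zero (lt_of_not_ge fun hle => hψ (hS hle hφ)) h hY f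

lemma dn_of_sem {S : Set ℝ} (hS : IsUpperSet S) {φ : ℝ} (hφ : φ ∉ S) {X : C} (h : P.sem φ X) :
    P.dn S X := fun _ hψ _ hY f =>
  P.hom_eq_zero (lt_of_not_ge fun hle => hφ (hS hle hψ)) hY h f

lemma exists_hasHN (X : C) : ∃ l, HasHN P.sem l X := by
  by_cases hX : IsZero X
  · exact ⟨[], .nil hX⟩
  · obtain ⟨F⟩ := P.exists_hn X hX
    obtain ⟨l, hl, -⟩ := F.hasHN
    exact ⟨l, hl⟩

lemma up_of_ext {S : Set ℝ} {X Y Z : C} {f : X ⟶ Y} {g : Y ⟶ Z} (T : Tri f g) (hX : P.up S X)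
    (hZ : P.up S Z) : P.up S Y := fun ψ hψ W hW k => by
  obtain ⟨l, hl⟩ := T.desc k (hX ψ hψ W hW _)
  rw [← hl, hZ ψ hψ W hW l, comp_zero]

lemma dn_of_ext {S : Set ℝ} {X Y Z : C} {f : X ⟶ Y} {g : Y ⟶ Z} (T : Tri f g) (hX : P.dn S X)
    (hZ : P.dn S Z) : P.dn S Y := fun ψ hψ W hW k => by
  obtain ⟨l, hl⟩ := T.lift k (hZ ψ hψ W hW _)
  rw [← hl, hX ψ hψ W hW l, zero_comp]

/-- Properties closed under extensions and containing the zero objects and the semistable objects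
of the given phases contain the objects with such a Harder-Narasimhan filtration. -/
lemma _root_.SlicingGlue.HasHN.induction {P : ℝ → ObjectProperty C} {R : ObjectProperty C}
    (h₀ : ∀ X, IsZero X → R X)
    (hext : ∀ {X Y Z : C} {f : X ⟶ Y} {g : Y ⟶ Z}, Tri f g → R X → R Z → R Y)
    {l : List ℝ} (hR : ∀ φ ∈ l, ∀ X, P φ X → R X) {X : C} (h : HasHN P l X) : R X := by
  induction h with
  | nil hX => exact h₀ _ hX
  | cons hX T hZ hZ' hl ih =>
    exact hext T (ih fun φ hφ => hR φ (by simp [hφ])) (hR _ (by simp) _ hZ)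

lemma up_of_hasHN {S : Set ℝ} (hS : IsUpperSet S) {l : List ℝ} {X : C} (h : HasHN P.sem l X)
    (hl : ∀ φ ∈ l, φ ∈ S) : P.up S X :=
  h.induction (fun _ hX _ _ _ _ _ => hX.eq_of_src _ _) (P.up_of_ext)
    fun _ hφ _ hY => P.up_of_sem hS (hl _ hφ) hY

lemma dn_of_hasHN {S : Set ℝ} (hS : IsUpperSet S) {l : List ℝ} {X : C} (h : HasHN P.sem l X)
    (hl : ∀ φ ∈ l, φ ∉ S) : P.dn S X :=
  h.induction (fun _ hX _ _ _ _ _ => hX.eq_of_tgt _ _) (P.dn_of_ext)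
    fun _ hφ _ hY => P.dn_of_sem hS (hl _ hφ) hY

lemma exists_tri [IsTriangulated C] {S : Set ℝ} (hS : IsUpperSet S) {l : List ℝ} {X : C}
    (h : HasHN P.sem l X) :
    ∃ (A B : C) (f : A ⟶ X) (g : X ⟶ B), Tri f g ∧ P.up S A ∧ P.dn S B := by
  induction h with
  | @nil X hX =>
    exact ⟨X, X, _, 0, Tri.of_isZero_right hX (Iso.refl X) 0,
      fun _ _ _ _ _ => hX.eq_of_src _ _, fun _ _ _ _ _ => hX.eq_of_tgt _ _⟩
  | @cons l X Y Z φ a b hX T hZ hZ' hl ih =>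
    by_cases hφ : φ ∈ S
    · exact ⟨Y, 0, _, 0, Tri.of_isZero_right (isZero_zero C) (Iso.refl Y) 0,
        P.up_of_hasHN hS (.cons hX T hZ hZ' hl) (by
          rintro ψ (_ | ⟨_, hψ⟩)
          exacts [hφ, hS (hl ψ hψ).le hφ]),
        fun _ _ _ _ _ => (isZero_zero C).eq_of_tgt _ _⟩
    · obtain ⟨A, B, f, g, T', hA, hB⟩ := ih
      obtain ⟨D, d, T''⟩ := exists_cone (f ≫ a)
      obtain ⟨m, n, TT, -, -⟩ := T'.octahedron T T''
      exact ⟨A, D, _, d, T'', hA, P.dn_of_ext TT hB (P.dn_of_sem hS hφ hZ)⟩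

lemma sem_shift_neg {φ : ℝ} {X : C} (h : P.sem φ X) : P.sem (φ - 1) (X⟦(-1 : ℤ)⟧) := by
  rw [← P.sem_shift, sub_add_cancel]
  exact P.sem_of_iso φ (shiftNegShift X (1 : ℤ)).symm h

lemma up_shift {S : Set ℝ} (X : C) : P.up S (X⟦(1 : ℤ)⟧) ↔ P.up ((· + 1) ⁻¹' S) X := by
  constructor
  · intro h ψ hψ Y hY f
    have := h _ hψ _ ((P.sem_shift _ _).2 hY) (f⟦(1 : ℤ)⟧')
    exact (shiftFunctor C (1 : ℤ)).map_injective (this.trans (Functor.map_zero _ _ _).symm)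
  · intro h ψ hψ Y hY f
    obtain ⟨g, hg⟩ := (shiftFunctor C (1 : ℤ)).map_surjective (f ≫ (shiftNegShift Y (1 : ℤ)).inv)
    rw [h (ψ - 1) (by simpa using hψ) _ (P.sem_shift_neg hY) g, Functor.map_zero] at hg
    rw [← cancel_mono (shiftNegShift Y (1 : ℤ)).inv, ← hg, zero_comp]

lemma dn_shift {S : Set ℝ} (X : C) : P.dn S (X⟦(1 : ℤ)⟧) ↔ P.dn ((· + 1) ⁻¹' S) X := by
  constructor
  · intro h ψ hψ Y hY f
    have := h _ hψ _ ((P.sem_shift _ _).2 hY) (f⟦(1 : ℤ)⟧')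
    exact (shiftFunctor C (1 : ℤ)).map_injective (this.trans (Functor.map_zero _ _ _).symm)
  · intro h ψ hψ Y hY f
    obtain ⟨g, hg⟩ := (shiftFunctor C (1 : ℤ)).map_surjective ((shiftNegShift Y (1 : ℤ)).hom ≫ f)
    rw [h (ψ - 1) (by simpa using hψ) _ (P.sem_shift_neg hY) g, Functor.map_zero] at hg
    rw [← cancel_epi (shiftNegShift Y (1 : ℤ)).hom, ← hg, comp_zero]

/-- The head `φ` of the list is the smallest phase. Were it outside `S`, the map from `X` onto the
last factor `Z` would vanish, making `Z` a retract of a shift with phases above `φ + 1`, hence zero.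
-/
lemma mem_of_up {S : Set ℝ} (hS : IsUpperSet S) {l : List ℝ} {X : C} (h : HasHN P.sem l X)
    (hX : P.up S X) : ∀ φ ∈ l, φ ∈ S := by
  cases h with
  | nil hX => simp
  | @cons l X' Y Z φ a b hX' T hZ hZ' hl =>
    suffices φ ∈ S by
      rintro ψ (_ | ⟨_, hψ⟩)
      exacts [this, hS (hl ψ hψ).le this]
    by_contra hφ
    obtain ⟨h, r, hr⟩ := T.exists_hom_of_zero (hX φ hφ Z hZ b)
    refine hZ' ((IsZero.iff_id_eq_zero Z).2 ?_)
    have : P.up (Set.Ioi φ) (X'⟦(1 : ℤ)⟧) := (P.up_shift X').2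
      (P.up_of_hasHN ((isUpperSet_Ioi φ).preimage fun _ _ h => by simpa using h) hX'
        fun ψ hψ => by have := hl ψ hψ; simp only [Set.mem_preimage, Set.mem_Ioi]; linarith)
    rw [← hr, this φ (by simp) Z hZ r, comp_zero]

lemma notMem_of_dn {S : Set ℝ} (hS : IsUpperSet S) {l : List ℝ} {X : C} (h : HasHN P.sem l X)
    (hX : P.dn S X) : ∀ φ ∈ l, φ ∉ S := by
  induction h generalizing S with
  | nil hX => simp
  | @cons l X' Y Z φ a b hX' T hZ hZ' hl ih =>
    -- A map to `X'` from phase at least `ψ` dies in `Y`, so it comes from `Z⟦-1⟧` of phase `φ - 1`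
    -- and vanishes. The induction hypothesis for `Set.Ici ψ` then contradicts that `ψ` occurs in
    -- `X'`.
    have key (ψ : ℝ) (hψ : ψ ∈ l) : ψ ∉ S := fun hψ' => by
      refine ih (isUpperSet_Ici ψ) (fun χ hχ W hW f => ?_) ψ hψ (by simp)
      obtain ⟨k, T'⟩ := T.invRot
      obtain ⟨m, hm⟩ := T'.lift f (hX χ (hS hχ hψ') W hW _)
      have := hl ψ hψ
      rw [← hm, P.hom_eq_zero (by simp only [Set.mem_Ici] at hχ; linarith) hW
        (P.sem_shift_neg hZ) m, zero_comp]
    rintro ψ (_ | ⟨_, hψ⟩)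
    · intro hφ
      cases l with
      | nil =>
        cases hX' with
        | nil hX' =>
        have := T.isIso_of_isZero_left hX'
        refine hZ' ((IsZero.iff_id_eq_zero Z).2 ?_)
        rw [← IsIso.inv_hom_id b, hX φ hφ Z hZ (inv b), zero_comp]
      | cons ψ l => exact key ψ (by simp) (hS (hl ψ (by simp)).le hφ)
    · exact key ψ hψ

lemma isCut [IsTriangulated C] {S : Set ℝ} (hS : IsUpperSet S) : IsCut (P.up S) (P.dn S) where
  hom_zero {X Y} hX hY f := by
    obtain ⟨l, hl⟩ := P.exists_hasHN Y
    have h := P.notMem_of_dn hS hl hY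
    refine hl.induction (R := fun Y => ∀ f : X ⟶ Y, f = 0) (fun _ h _ => h.eq_of_tgt _ _)
      (fun T h₁ h₂ f => ?_) (fun φ hφ Z hZ f => hX φ (h φ hφ) Z hZ f) f
    obtain ⟨k, hk⟩ := T.lift f (h₂ _)
    rw [← hk, h₁ k, zero_comp]
  up_retract {X Y i r} h hY ψ hψ Z hZ f := by
    rw [← Category.id_comp f, ← h, Category.assoc, hY ψ hψ Z hZ (r ≫ f), comp_zero]
  dn_retract {X Y i r} h hY ψ hψ Z hZ f := by
    rw [← Category.comp_id f, ← h, ← Category.assoc, hY ψ hψ Z hZ (f ≫ i), zero_comp]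
  exists_tri X := by
    obtain ⟨l, hl⟩ := P.exists_hasHN X
    exact P.exists_tri hS hl

lemma interval_iff [IsTriangulated C] {S T : Set ℝ} (hS : IsUpperSet S) (hT : IsUpperSet T)
    (X : C) : P.interval (S \ T) X ↔ P.up S X ∧ P.dn T X := by
  constructor
  · rintro ⟨F, hF⟩
    obtain ⟨l, hl, hl'⟩ := F.hasHN
    have (ψ : ℝ) (hψ : ψ ∈ l) : ψ ∈ S \ T := by
      obtain ⟨i, rfl⟩ := (hl' ψ).1 hψ
      exact hF i
    exact ⟨P.up_of_hasHN hS hl fun ψ hψ => (this ψ hψ).1,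
      P.dn_of_hasHN hT hl fun ψ hψ => (this ψ hψ).2⟩
  · rintro ⟨h, h'⟩
    obtain ⟨l, hl⟩ := P.exists_hasHN X
    obtain ⟨F, hF⟩ := hl.exists_filtration
    exact ⟨F, fun i => ⟨P.mem_of_up hS hl h _ ((hF _).2 ⟨i, rfl⟩),
      P.notMem_of_dn hT hl h' _ ((hF _).2 ⟨i, rfl⟩)⟩⟩

lemma interval_Ioo_iff [IsTriangulated C] (a b : ℝ) (X : C) :
    P.interval (Set.Ioo a b) X ↔ P.up (Set.Ioi a) X ∧ P.dn (Set.Ici b) X := by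
  rw [← P.interval_iff (isUpperSet_Ioi a) (isUpperSet_Ici b), Set.Ioi_sdiff_Ici]

lemma sem_iff [IsTriangulated C] (φ : ℝ) (X : C) :
    P.sem φ X ↔ P.up (Set.Ici φ) X ∧ P.dn (Set.Ioi φ) X := by
  refine ⟨fun h => ⟨P.up_of_sem (isUpperSet_Ici φ) (by simp) h,
    P.dn_of_sem (isUpperSet_Ioi φ) (by simp) h⟩, fun ⟨h, h'⟩ => ?_⟩
  obtain ⟨l, hl⟩ := P.exists_hasHN X
  have hl' (ψ : ℝ) (hψ : ψ ∈ l) : ψ = φ :=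
    le_antisymm (not_lt.1 (P.notMem_of_dn (isUpperSet_Ioi φ) hl h' ψ hψ))
      (P.mem_of_up (isUpperSet_Ici φ) hl h ψ hψ)
  cases hl with
  | nil hX => exact P.sem_of_iso φ hX.isoZero.symm (P.sem_zero φ)
  | @cons l X Y Z ψ a b hX T hZ hZ' hl =>
    obtain rfl : ψ = φ := hl' ψ (by simp)
    cases hX with
    | nil hX =>
      have := T.isIso_of_isZero_left hX
      exact P.sem_of_iso ψ (asIso b).symm hZ
    | @cons l X Y Z χ _ _ _ _ _ _ _ =>
      exact absurd (hl' χ (by simp)) (hl χ (by simp)).ne'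

lemma exists_isLeast_phases {X : C} (hX : ¬ IsZero X) : ∃ l, HasHN P.sem l X ∧
    IsLeast {φ | φ ∈ l} (P.minPhase X) ∧ IsGreatest {φ | φ ∈ l} (P.maxPhase X) := by
  obtain ⟨l, hl⟩ := P.exists_hasHN X
  have hne : l.toFinset.Nonempty := by
    rw [List.toFinset_nonempty_iff]
    rintro rfl
    cases hl with
    | nil h => exact hX h
  obtain ⟨F₀, hF₀⟩ := hl.exists_filtration
  have hmem (φ : ℝ) (hφ : φ ∈ l) : φ ∈ P.phases X := by
    obtain ⟨i, hi⟩ := (hF₀ φ).1 hφ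
    exact ⟨F₀, i, hi⟩
  obtain ⟨m, hm, hm'⟩ := l.toFinset.exists_minimal hne
  obtain ⟨M, hM, hM'⟩ := l.toFinset.exists_maximal hne
  rw [List.mem_toFinset] at hm hM
  have hle (φ : ℝ) (hφ : φ ∈ l) : m ≤ φ := by
    by_contra! h
    exact absurd (hm' (by simpa using hφ) h.le) (not_le.2 h)
  have hge (φ : ℝ) (hφ : φ ∈ l) : φ ≤ M := by
    by_contra! h
    exact absurd (hM' (by simpa using hφ) h.le) (not_le.2 h)
  -- Being in `up` or `dn` is defined by orthogonality and does not see the chosen filtration, so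
  -- the bounds read off from `l` hold for every filtration.
  have hmin : IsLeast (P.phases X) m := by
    refine ⟨hmem m hm, ?_⟩
    rintro _ ⟨F, i, rfl⟩
    obtain ⟨l', hl', h⟩ := F.hasHN
    exact P.mem_of_up (isUpperSet_Ici m) hl' (P.up_of_hasHN (isUpperSet_Ici m) hl hle) _
      ((h _).2 ⟨i, rfl⟩)
  have hmax : IsGreatest (P.phases X) M := by
    refine ⟨hmem M hM, ?_⟩
    rintro _ ⟨F, i, rfl⟩
    obtain ⟨l', hl', h⟩ := F.hasHN
    exact not_lt.1 (P.notMem_of_dn (isUpperSet_Ioi M) hl'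
      (P.dn_of_hasHN (isUpperSet_Ioi M) hl fun φ hφ => not_lt.2 (hge φ hφ)) _
      ((h _).2 ⟨i, rfl⟩))
  refine ⟨l, hl, ?_, ?_⟩
  · rw [minPhase, hmin.csInf_eq]
    exact ⟨hm, hle⟩
  · rw [maxPhase, hmax.csSup_eq]
    exact ⟨hM, hge⟩

lemma up_iff_minPhase {S : Set ℝ} (hS : IsUpperSet S) {X : C} (hX : ¬ IsZero X) :
    P.up S X ↔ P.minPhase X ∈ S := by
  obtain ⟨l, hl, h, -⟩ := P.exists_isLeast_phases hX
  exact ⟨fun h' => P.mem_of_up hS hl h' _ h.1,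
    fun h' => P.up_of_hasHN hS hl fun φ hφ => hS (h.2 hφ) h'⟩

lemma dn_iff_maxPhase {S : Set ℝ} (hS : IsUpperSet S) {X : C} (hX : ¬ IsZero X) :
    P.dn S X ↔ P.maxPhase X ∉ S := by
  obtain ⟨l, hl, -, h⟩ := P.exists_isLeast_phases hX
  exact ⟨fun h' => P.notMem_of_dn hS hl h' _ h.1,
    fun h' => P.dn_of_hasHN hS hl fun φ hφ hφ' => h' (hS (h.2 hφ) hφ')⟩

lemma up_of_isZero (S : Set ℝ) {X : C} (hX : IsZero X) : P.up S X :=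
  fun _ _ _ _ _ => hX.eq_of_src _ _

lemma dn_of_isZero (S : Set ℝ) {X : C} (hX : IsZero X) : P.dn S X :=
  fun _ _ _ _ _ => hX.eq_of_tgt _ _

lemma up_mono {S T : Set ℝ} (h : S ⊆ T) {X : C} (hX : P.up S X) : P.up T X :=
  fun ψ hψ => hX ψ fun h' => hψ (h h')

lemma dn_anti {S T : Set ℝ} (h : S ⊆ T) {X : C} (hX : P.dn T X) : P.dn S X :=
  fun ψ hψ => hX ψ (h hψ)

variable {P}

lemma abs_sub_lt_of_edist_lt {Q : Slicing C} {ε : ℝ} (h : edist P Q < ENNReal.ofReal ε) {X : C}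
    (hX : ¬ IsZero X) :
    |P.minPhase X - Q.minPhase X| < ε ∧ |P.maxPhase X - Q.maxPhase X| < ε := by
  have := (le_iSup₂ (f := fun (X : C) (_ : ¬ IsZero X) => ENNReal.ofReal
    (max |P.minPhase X - Q.minPhase X| |P.maxPhase X - Q.maxPhase X|)) X hX).trans_lt h
  exact max_lt_iff.1 ((ENNReal.ofReal_lt_ofReal_iff').1 this).1

/-- The distance is strictly below `ε`, which is why a closed bound becomes an open one. This is the
form in which the metric enters the gluing. -/
lemma up_of_edist_lt {Q : Slicing C} {ε : ℝ} (h : edist P Q < ENNReal.ofReal ε) {t : ℝ} {X : C}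
    (hX : P.up (Set.Ici (t + ε)) X) : Q.up (Set.Ioi t) X := by
  by_cases h0 : IsZero X
  · exact Q.up_of_isZero _ h0
  rw [up_iff_minPhase _ (isUpperSet_Ici _) h0, Set.mem_Ici] at hX
  rw [up_iff_minPhase _ (isUpperSet_Ioi _) h0, Set.mem_Ioi]
  have := (abs_lt.1 (abs_sub_lt_of_edist_lt h h0).1).2
  linarith

variable {D : Type u'} [Category.{v'} D] [HasZeroObject D] [HasShift D ℤ] [Preadditive D]
    [∀ n : ℤ, (shiftFunctor D n).Additive] [Pretriangulated D] {Q : Slicing D}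
    (F : C ⥤ D) [F.CommShift ℤ] [F.IsTriangulated]

lemma up_map (h : ∀ φ X, P.sem φ X → Q.sem φ (F.obj X)) {S : Set ℝ} (hS : IsUpperSet S) {X : C}
    (hX : P.up S X) : Q.up S (F.obj X) := by
  obtain ⟨l, hl⟩ := P.exists_hasHN X
  have hl' := P.mem_of_up hS hl hX
  exact hl.induction (R := fun X => Q.up S (F.obj X))
    (fun X hX => Q.up_of_isZero S (F.map_isZero hX)) (fun T => Q.up_of_ext (T.map F))
    fun φ hφ X hX => Q.up_of_sem hS (hl' φ hφ) (h φ X hX)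

lemma dn_map (h : ∀ φ X, P.sem φ X → Q.sem φ (F.obj X)) {S : Set ℝ} (hS : IsUpperSet S) {X : C}
    (hX : P.dn S X) : Q.dn S (F.obj X) := by
  obtain ⟨l, hl⟩ := P.exists_hasHN X
  have hl' := P.notMem_of_dn hS hl hX
  exact hl.induction (R := fun X => Q.dn S (F.obj X))
    (fun X hX => Q.dn_of_isZero S (F.map_isZero hX)) (fun T => Q.dn_of_ext (T.map F))
    fun φ hφ X hX => Q.dn_of_sem hS (hl' φ hφ) (h φ X hX)

end Slicing

end SlicingCuts

/-! ### Kernels, cokernels and strict morphisms in elementary terms. -/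

section Kernels

variable {A : Type u} [Category.{v} A] [HasZeroMorphisms A]

/-- The morphism `f` is a kernel of `g`. -/
structure IsKer {X Y Z : A} (f : X ⟶ Y) (g : Y ⟶ Z) : Prop where
  zero : f ≫ g = 0
  mono : Mono f
  lift {W : A} (k : W ⟶ Y) (hk : k ≫ g = 0) : ∃ l : W ⟶ X, l ≫ f = k

/-- The morphism `g` is a cokernel of `f`. -/
structure IsCoker {X Y Z : A} (f : X ⟶ Y) (g : Y ⟶ Z) : Prop where
  zero : f ≫ g = 0
  epi : Epi g
  desc {W : A} (k : Y ⟶ W) (hk : f ≫ k = 0) : ∃ l : Z ⟶ W, g ≫ l = k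

lemma IsKer.hasKernel {X Y Z : A} {f : X ⟶ Y} {g : Y ⟶ Z} (h : IsKer f g) : HasKernel g := by
  have := h.mono
  exact ⟨⟨_, KernelFork.IsLimit.ofι' f h.zero fun k hk =>
    ⟨(h.lift k hk).choose, (h.lift k hk).choose_spec⟩⟩⟩

lemma IsCoker.hasCokernel {X Y Z : A} {f : X ⟶ Y} {g : Y ⟶ Z} (h : IsCoker f g) :
    HasCokernel f := by
  have := h.epi
  exact ⟨⟨_, CokernelCofork.IsColimit.ofπ g h.zero (fun k hk => (h.desc k hk).choose)
    (fun k hk => (h.desc k hk).choose_spec) fun k hk m hm => by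
      rw [← cancel_epi g, hm, (h.desc k hk).choose_spec]⟩⟩

variable [HasKernels A] [HasCokernels A]

lemma IsCoker.isStrictHom {X Y Z : A} {f : X ⟶ Y} {g : Y ⟶ Z} (h : IsCoker f g) :
    IsStrictHom g := by
  have := h.epi
  have h₀ : cokernel.π g = 0 := by rw [← cancel_epi g, cokernel.condition, comp_zero]
  have : IsIso (kernel.ι (cokernel.π g)) := by
    rw [h₀]
    infer_instance
  obtain ⟨d, hd⟩ := h.desc (Abelian.coimage.π g) (by
    rw [← kernel.lift_ι g f h.zero, Category.assoc, cokernel.condition, comp_zero])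
  have fac := Abelian.coimage_image_factorisation g
  have : IsIso (Abelian.coimageImageComparison g ≫ Abelian.image.ι g) := by
    refine ⟨d, ?_, ?_⟩
    · rw [← cancel_epi (Abelian.coimage.π g), Category.assoc, reassoc_of% fac, hd, Category.comp_id]
    · rw [← cancel_epi g, reassoc_of% hd, fac, Category.comp_id]
  exact IsIso.of_isIso_comp_right _ (Abelian.image.ι g)

lemma IsKer.isStrictHom {X Y Z : A} {f : X ⟶ Y} {g : Y ⟶ Z} (h : IsKer f g) :
    IsStrictHom f := by
  have := h.mono
  have h₀ : kernel.ι f = 0 := by rw [← cancel_mono f, kernel.condition, zero_comp]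
  have : IsIso (cokernel.π (kernel.ι f)) := by
    rw [h₀]
    infer_instance
  obtain ⟨d, hd⟩ := h.lift (Abelian.image.ι f) (by
    rw [← cokernel.π_desc f g h.zero, kernel.condition_assoc, zero_comp])
  have fac := Abelian.coimage_image_factorisation f
  have : IsIso (Abelian.coimage.π f ≫ Abelian.coimageImageComparison f) := by
    refine ⟨d, ?_, ?_⟩
    · rw [← cancel_mono f, Category.assoc, hd, Category.assoc, fac, Category.id_comp]
    · rw [← cancel_mono (Abelian.image.ι f), Category.assoc, Category.assoc, fac, hd,
        Category.id_comp]
  exact IsIso.of_isIso_comp_left (Abelian.coimage.π f) _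

lemma IsKer.isCoker {X Y Z : A} {f : X ⟶ Y} {g : Y ⟶ Z} (h : IsKer f g) (hg : Epi g)
    (hs : IsStrictHom g) : IsCoker f g := by
  refine ⟨h.zero, hg, fun {W} k hk => ?_⟩
  have h₀ : cokernel.π g = 0 := by rw [← cancel_epi g, cokernel.condition, comp_zero]
  have : IsIso (kernel.ι (cokernel.π g)) := by
    rw [h₀]
    infer_instance
  have : IsIso (Abelian.coimageImageComparison g) := hs
  have fac := Abelian.coimage_image_factorisation g
  obtain ⟨l, hl⟩ := h.lift (kernel.ι g) (kernel.condition g)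
  refine ⟨inv (Abelian.coimageImageComparison g ≫ Abelian.image.ι g) ≫
    cokernel.desc (kernel.ι g) k (by rw [← hl, Category.assoc, hk, comp_zero]), ?_⟩
  conv_lhs => enter [1]; rw [← fac]
  rw [Category.assoc, IsIso.hom_inv_id_assoc, cokernel.π_desc]

lemma IsCoker.isKer {X Y Z : A} {f : X ⟶ Y} {g : Y ⟶ Z} (h : IsCoker f g) (hf : Mono f)
    (hs : IsStrictHom f) : IsKer f g := by
  refine ⟨h.zero, hf, fun {W} k hk => ?_⟩
  have h₀ : kernel.ι f = 0 := by rw [← cancel_mono f, kernel.condition, zero_comp]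
  have : IsIso (cokernel.π (kernel.ι f)) := by
    rw [h₀]
    infer_instance
  have : IsIso (Abelian.coimageImageComparison f) := hs
  have fac := Abelian.coimage_image_factorisation f
  obtain ⟨l, hl⟩ := h.desc (cokernel.π f) (cokernel.condition f)
  refine ⟨kernel.lift (cokernel.π f) k (by rw [← hl, reassoc_of% hk, zero_comp]) ≫
    inv (Abelian.coimage.π f ≫ Abelian.coimageImageComparison f), ?_⟩
  conv_lhs => enter [2]; rw [← fac]
  rw [← Category.assoc (Abelian.coimage.π f), Category.assoc, IsIso.inv_hom_id_assoc,
    kernel.lift_ι]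

end Kernels

/-! ### The quasi-abelian category between two close torsion pairs. -/

section Thin

variable {C : Type u} [Category.{v} C] [HasZeroObject C] [HasShift C ℤ] [Preadditive C]
  [∀ n : ℤ, (shiftFunctor C n).Additive] [Pretriangulated C]

/-- Two torsion pairs `(U, L)` and `(U', L')` with `U[1] ⊆ U' ⊆ U`, so that `U ⊓ L'` behaves like
the objects of a quasi-abelian category. -/
structure IsThin (U L U' L' : ObjectProperty C) : Prop where
  cut : IsCut U L
  cut' : IsCut U' L'
  le : U' ≤ U
  shift {X : C} : U X → U' (X⟦(1 : ℤ)⟧)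

namespace IsThin

variable {U L U' L' : ObjectProperty C} (h : IsThin U L U' L')
include h

lemma dn_le : L ≤ L' := (h.cut'.le_iff h.cut).1 h.le

lemma dn_shift {X : C} (hX : L' X) : L (X⟦(-1 : ℤ)⟧) := h.cut.dn_shift h.cut' (fun _ => h.shift) hX

lemma up_cone {X Y Z : C} {f : X ⟶ Y} {g : Y ⟶ Z} (T : Tri f g) (hX : U X) (hY : U Y) : U Z :=
  h.cut.up_cone T hY (h.le _ (h.shift hX))

lemma dn_fiber {X Y Z : C} {f : X ⟶ Y} {g : Y ⟶ Z} (T : Tri f g) (hY : L' Y) (hZ : L' Z) : L' X :=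
  h.cut'.dn_fiber T hY (h.dn_le _ (h.dn_shift hZ))

lemma cancel_left {X Y Z W : C} {f : X ⟶ Y} {g : Y ⟶ Z} (T : Tri f g) (hX : U X) (hW : L' W)
    {k : Z ⟶ W} (hk : g ≫ k = 0) : k = 0 := by
  obtain ⟨d, T'⟩ := T.rot
  obtain ⟨l, rfl⟩ := T'.desc k hk
  rw [h.cut'.hom_zero (h.shift hX) hW l, comp_zero]

lemma cancel_right {X Y Z W : C} {f : X ⟶ Y} {g : Y ⟶ Z} (T : Tri f g) (hZ : L' Z) (hW : U W)
    {k : W ⟶ X} (hk : k ≫ f = 0) : k = 0 := by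
  obtain ⟨d, T'⟩ := T.invRot
  obtain ⟨l, rfl⟩ := T'.lift k hk
  rw [h.cut.hom_zero hW (h.dn_shift hZ) l, zero_comp]

variable {A : ObjectProperty C} (hA : ∀ X, A X ↔ U X ∧ L' X)
include hA

/-- The cokernel is the cone with its `U'`-part cut off: objects of `A` receive no nonzero map from
`U'` or from `X⟦1⟧`, so maps out of `Y` killing `f` factor uniquely through `V` and then through
`Z`. Kernels are dual. -/
lemma isCoker {X Y Z : A.FullSubcategory} {f : X ⟶ Y} {V W : C} {p : Y.obj ⟶ V} {m : W ⟶ V}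
    {q : V ⟶ Z.obj} (T : Tri f.hom p) (T' : Tri m q) (hW : U' W) :
    IsCoker f (ObjectProperty.homMk (p ≫ q) : Y ⟶ Z) where
  zero := by
    ext
    exact (reassoc_of% T.zero) q |>.trans zero_comp
  epi := by
    refine Preadditive.epi_of_cancel_zero _ fun {B} k hk => ?_
    ext
    have hk' : p ≫ q ≫ k.hom = 0 := by
      rw [← Category.assoc]
      exact congrArg (·.hom) hk
    exact h.cancel_left T' (h.le _ hW) ((hA _).1 B.2).2
      (h.cancel_left T ((hA _).1 X.2).1 ((hA _).1 B.2).2 hk')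
  desc {B} k hk := by
    obtain ⟨l, hl⟩ := T.desc k.hom (congrArg (·.hom) hk)
    obtain ⟨l', hl'⟩ := T'.desc l (h.cut'.hom_zero hW ((hA _).1 B.2).2 _)
    refine ⟨ObjectProperty.homMk l', ?_⟩
    ext
    change (p ≫ q) ≫ l' = k.hom
    rw [Category.assoc, hl', hl]

lemma isKer {X Y Z : A.FullSubcategory} {f : X ⟶ Y} {V W : C} {p : V ⟶ X.obj} {m : V ⟶ W}
    {q : Z.obj ⟶ V} (T : Tri p f.hom) (T' : Tri q m) (hW : L W) :
    IsKer (ObjectProperty.homMk (q ≫ p) : Z ⟶ X) f where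
  zero := by
    ext
    change (q ≫ p) ≫ f.hom = 0
    rw [Category.assoc, T.zero, comp_zero]
  mono := by
    refine Preadditive.mono_of_cancel_zero _ fun {B} k hk => ?_
    ext
    have hk' : (k.hom ≫ q) ≫ p = 0 := by
      rw [Category.assoc]
      exact congrArg (·.hom) hk
    exact h.cancel_right T' (h.dn_le _ hW) ((hA _).1 B.2).1
      (h.cancel_right T ((hA _).1 Y.2).2 ((hA _).1 B.2).1 hk')
  lift {B} k hk := by
    obtain ⟨l, hl⟩ := T.lift k.hom (congrArg (·.hom) hk)
    obtain ⟨l', hl'⟩ := T'.lift l (h.cut.hom_zero ((hA _).1 B.2).1 hW _)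
    refine ⟨ObjectProperty.homMk l', ?_⟩
    ext
    change l' ≫ q ≫ p = k.hom
    rw [← Category.assoc, hl', hl]

lemma exists_isCoker {X Y : A.FullSubcategory} (f : X ⟶ Y) :
    ∃ (Z : A.FullSubcategory) (V W : C) (p : Y.obj ⟶ V) (m : W ⟶ V) (q : V ⟶ Z.obj),
      Tri f.hom p ∧ Tri m q ∧ U' W := by
  obtain ⟨V, p, T⟩ := exists_cone f.hom
  obtain ⟨W, Z, m, q, T', hW, hZ⟩ := h.cut'.exists_tri V
  have hV := h.up_cone T ((hA _).1 X.2).1 ((hA _).1 Y.2).1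
  exact ⟨⟨Z, (hA _).2 ⟨h.up_cone T' (h.le _ hW) hV, hZ⟩⟩, V, W, p, m, q, T, T', hW⟩

lemma exists_isKer {X Y : A.FullSubcategory} (f : X ⟶ Y) :
    ∃ (Z : A.FullSubcategory) (V W : C) (p : V ⟶ X.obj) (m : V ⟶ W) (q : Z.obj ⟶ V),
      Tri p f.hom ∧ Tri q m ∧ L W := by
  obtain ⟨V, p, T⟩ := exists_fiber f.hom
  obtain ⟨Z, W, q, m, T', hZ, hW⟩ := h.cut.exists_tri V
  have hV := h.dn_fiber T ((hA _).1 X.2).2 ((hA _).1 Y.2).2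
  exact ⟨⟨Z, (hA _).2 ⟨hZ, h.dn_fiber T' hV (h.dn_le _ hW)⟩⟩, V, W, p, m, q, T, T', hW⟩

lemma hasCokernels : HasCokernels A.FullSubcategory where
  has_colimit f := by
    obtain ⟨Z, V, W, p, m, q, T, T', hW⟩ := h.exists_isCoker hA f
    exact (h.isCoker hA T T' hW).hasCokernel

lemma hasKernels : HasKernels A.FullSubcategory where
  has_limit f := by
    obtain ⟨Z, V, W, p, m, q, T, T', hW⟩ := h.exists_isKer hA f
    exact (h.isKer hA T T' hW).hasKernel

lemma isCoker_of_tri {X Y Z : A.FullSubcategory} {f : X ⟶ Y} {g : Y ⟶ Z} (T : Tri f.hom g.hom) :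
    IsCoker f g := by
  have := h.isCoker hA (Z := Z) T (Tri.of_isZero_left (isZero_zero C) 0 (Iso.refl Z.obj))
    (h.cut'.up_zero (isZero_zero C))
  convert this
  ext
  exact (Category.comp_id _).symm

lemma isKer_of_tri {X Y Z : A.FullSubcategory} {f : X ⟶ Y} {g : Y ⟶ Z} (T : Tri f.hom g.hom) :
    IsKer f g := by
  have := h.isKer hA (Z := X) T (Tri.of_isZero_right (isZero_zero C) (Iso.refl X.obj) 0)
    (h.cut.dn_zero (isZero_zero C))
  convert this
  ext
  exact (Category.id_comp _).symm

lemma strictEpi_of_tri [HasKernels A.FullSubcategory] [HasCokernels A.FullSubcategory]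
    {Y Z : A.FullSubcategory} {g : Y ⟶ Z} {X : C} {f : X ⟶ Y.obj} (T : Tri f g.hom) (hX : U X) :
    Epi g ∧ IsStrictHom g := by
  let X' : A.FullSubcategory :=
    ⟨X, (hA _).2 ⟨hX, h.dn_fiber T ((hA _).1 Y.2).2 ((hA _).1 Z.2).2⟩⟩
  have := h.isCoker_of_tri hA (X := X') (f := ObjectProperty.homMk f) T
  exact ⟨this.epi, this.isStrictHom⟩

lemma strictMono_of_tri [HasKernels A.FullSubcategory] [HasCokernels A.FullSubcategory]
    {X Y : A.FullSubcategory} {f : X ⟶ Y} {Z : C} {g : Y.obj ⟶ Z} (T : Tri f.hom g) (hZ : L' Z) :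
    Mono f ∧ IsStrictHom f := by
  let Z' : A.FullSubcategory :=
    ⟨Z, (hA _).2 ⟨h.up_cone T ((hA _).1 X.2).1 ((hA _).1 Y.2).1, hZ⟩⟩
  have := h.isKer_of_tri hA (Z := Z') (g := ObjectProperty.homMk g) T
  exact ⟨this.mono, this.isStrictHom⟩

variable [IsTriangulated C]

/-- A strict epimorphism is the cokernel of its kernel `K`. The cone of `K ⟶ Y` is an extension of
`Z` by an object of `L`, hence lies in `A`; being also a cokernel of `K ⟶ Y`, it is isomorphic to
`Z`. -/
lemma exists_tri_of_strictEpi [HasKernels A.FullSubcategory] [HasCokernels A.FullSubcategory]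
    {Y Z : A.FullSubcategory} {g : Y ⟶ Z} (hg : Epi g) (hg' : IsStrictHom g) :
    ∃ (X : A.FullSubcategory) (f : X ⟶ Y), Tri f.hom g.hom := by
  obtain ⟨K, F, W, p, m, q, T, T', hW⟩ := h.exists_isKer hA g
  have hk := h.isKer hA T T' hW
  have hc := hk.isCoker hg hg'
  refine ⟨K, ObjectProperty.homMk (q ≫ p), ?_⟩
  obtain ⟨V, r, TV⟩ := exists_cone (q ≫ p)
  obtain ⟨a, b, T'', -, -⟩ := T'.octahedron T TV
  have hV : A V := (hA _).2 ⟨h.up_cone TV ((hA _).1 K.2).1 ((hA _).1 Y.2).1,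
    h.cut'.dn_ext T'' (h.dn_le _ hW) ((hA _).1 Z.2).2⟩
  have hc' := h.isCoker_of_tri hA (X := K) (Y := Y) (Z := ⟨V, hV⟩)
    (f := ObjectProperty.homMk (q ≫ p)) (g := ObjectProperty.homMk r) TV
  obtain ⟨s, hs⟩ := hc.desc _ hc'.zero
  obtain ⟨t, ht⟩ := hc'.desc _ hc.zero
  have := hc'.epi
  let e : (⟨V, hV⟩ : A.FullSubcategory) ≅ Z := ⟨t, s, by
    rw [← cancel_epi (ObjectProperty.homMk r : Y ⟶ ⟨V, hV⟩), reassoc_of% ht, hs,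
      Category.comp_id], by
    rw [← cancel_epi g, reassoc_of% hs, ht, Category.comp_id]⟩
  have hg : g.hom = r ≫ (A.ι.mapIso e).hom := congrArg (·.hom) ht.symm
  rw [hg]
  exact TV.iso_right (A.ι.mapIso e)

lemma exists_tri_of_strictMono [HasKernels A.FullSubcategory] [HasCokernels A.FullSubcategory]
    {X Y : A.FullSubcategory} {f : X ⟶ Y} (hf : Mono f) (hf' : IsStrictHom f) :
    ∃ (Z : A.FullSubcategory) (g : Y ⟶ Z), Tri f.hom g.hom := by
  obtain ⟨Q, V, W, p, m, q, T, T', hW⟩ := h.exists_isCoker hA f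
  have hc := h.isCoker hA T T' hW
  have hk := hc.isKer hf hf'
  refine ⟨Q, ObjectProperty.homMk (p ≫ q), ?_⟩
  obtain ⟨F, r, TF⟩ := exists_fiber (p ≫ q)
  obtain ⟨a, b, T'', -, -⟩ := T.octahedron' T' TF
  have hF : A F := (hA _).2 ⟨h.cut.up_ext T'' ((hA _).1 X.2).1 (h.le _ hW),
    h.dn_fiber TF ((hA _).1 Y.2).2 ((hA _).1 Q.2).2⟩
  have hk' := h.isKer_of_tri hA (X := ⟨F, hF⟩) (Y := Y) (Z := Q)
    (f := ObjectProperty.homMk r) (g := ObjectProperty.homMk (p ≫ q)) TF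
  obtain ⟨s, hs⟩ := hk.lift _ hk'.zero
  obtain ⟨t, ht⟩ := hk'.lift _ hk.zero
  have := hk'.mono
  let e : X ≅ (⟨F, hF⟩ : A.FullSubcategory) := ⟨t, s, by
    rw [← cancel_mono f, Category.assoc, hs, ht, Category.id_comp], by
    rw [← cancel_mono (ObjectProperty.homMk r : ⟨F, hF⟩ ⟶ Y), Category.assoc, ht, hs,
      Category.id_comp]⟩
  have hf : f.hom = (A.ι.mapIso e).hom ≫ r := congrArg (·.hom) ht.symm
  rw [hf]
  exact TF.iso_left (A.ι.mapIso e)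

/-- The fiber of `g` is a cone of the map from the fiber of `f` to that of `f ≫ g`. The shifted
fiber of `f` is an extension of `X⟦1⟧` by `Y`, hence in `U`, so the fiber of `g` is in `U` too. -/
lemma strictEpi_of_comp [HasKernels A.FullSubcategory] [HasCokernels A.FullSubcategory]
    {X Y Z : A.FullSubcategory} {f : X ⟶ Y} {g : Y ⟶ Z} {V : C} {k : V ⟶ X.obj}
    (T : Tri k (f ≫ g).hom) (hV : U V) : Epi g ∧ IsStrictHom g := by
  obtain ⟨F, m, TF⟩ := exists_fiber f.hom
  obtain ⟨G, n, TG⟩ := exists_fiber g.hom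
  obtain ⟨a, b, T', -, -⟩ := TF.octahedron' TG T
  obtain ⟨d, TF'⟩ := TF.rot
  obtain ⟨d', TF''⟩ := TF'.rot
  refine h.strictEpi_of_tri hA TG (h.cut.up_cone T' hV ?_)
  exact h.cut.up_ext TF'' ((hA _).1 Y.2).1 (h.le _ (h.shift ((hA _).1 X.2).1))

lemma strictMono_of_comp [HasKernels A.FullSubcategory] [HasCokernels A.FullSubcategory]
    {X Y Z : A.FullSubcategory} {f : X ⟶ Y} {g : Y ⟶ Z} {V : C} {k : Z.obj ⟶ V}
    (T : Tri (f ≫ g).hom k) (hV : L' V) : Mono f ∧ IsStrictHom f := by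
  obtain ⟨F, m, TF⟩ := exists_cone f.hom
  obtain ⟨G, n, TG⟩ := exists_cone g.hom
  obtain ⟨a, b, T', -, -⟩ := TF.octahedron TG T
  obtain ⟨d, TG'⟩ := TG.invRot
  obtain ⟨d', TG''⟩ := TG'.invRot
  refine h.strictMono_of_tri hA TF (h.cut'.dn_fiber T' hV ?_)
  exact h.cut'.dn_ext TG'' (h.dn_le _ (h.dn_shift ((hA _).1 Z.2).2)) ((hA _).1 Y.2).2

lemma isQuasiAbelian : IsQuasiAbelian A.FullSubcategory := by
  have := h.hasKernels hA
  have := h.hasCokernels hA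
  have ho : HasZeroObject A.FullSubcategory :=
    ⟨⟨0, (hA _).2 ⟨h.cut.up_zero (isZero_zero C), h.cut'.dn_zero (isZero_zero C)⟩⟩, by
      rw [IsZero.iff_id_eq_zero]
      ext⟩
  have hb : HasBinaryBiproducts A.FullSubcategory := by
    refine ⟨fun X Y => ?_⟩
    let B : A.FullSubcategory := ⟨X.obj ⊞ Y.obj,
      (hA _).2 ⟨h.cut.up_biprod ((hA _).1 X.2).1 ((hA _).1 Y.2).1,
        h.cut'.dn_biprod ((hA _).1 X.2).2 ((hA _).1 Y.2).2⟩⟩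
    let b : BinaryBicone X Y :=
      { pt := B
        fst := ObjectProperty.homMk biprod.fst
        snd := ObjectProperty.homMk biprod.snd
        inl := ObjectProperty.homMk biprod.inl
        inr := ObjectProperty.homMk biprod.inr
        inl_fst := by ext; exact biprod.inl_fst
        inl_snd := by ext; exact biprod.inl_snd
        inr_fst := by ext; exact biprod.inr_fst
        inr_snd := by ext; exact biprod.inr_snd }
    exact hasBinaryBiproduct_of_total b (by
      ext : 1; exact biprod.total (X := X.obj) (Y := Y.obj))
  refine { strictEpi_of_isPullback := ?_, strictMono_of_isPushout := ?_ }
  · intro W X Y Z p q f g sq hg hg'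
    obtain ⟨K, k, δ, T⟩ := h.exists_tri_of_strictEpi hA hg hg'
    -- `V` is the homotopy pullback. It is an extension of `X` by `K`, so it lies in `A` and maps to
    -- the pullback `W`; the composite to `X` has fiber `K`, hence so does `strictEpi_of_comp` apply
    -- to `p`. The pushout case is dual.
    obtain ⟨V, a, b, T'⟩ := distinguished_cocone_triangle₂ (f.hom ≫ δ)
    obtain ⟨c, -, hc⟩ := complete_distinguished_triangle_morphism₂ _ _ T' T (𝟙 K.obj) f.hom
      (show (f.hom ≫ δ) ≫ (𝟙 K.obj)⟦(1 : ℤ)⟧' = f.hom ≫ δ by simp)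
    have T₀ : Tri a b := ⟨_, T'⟩
    let V' : A.FullSubcategory := ⟨V, (hA _).2
      ⟨h.cut.up_ext T₀ ((hA _).1 K.2).1 ((hA _).1 X.2).1,
        h.cut'.dn_ext T₀ ((hA _).1 K.2).2 ((hA _).1 X.2).2⟩⟩
    let b' : V' ⟶ X := ObjectProperty.homMk b
    let c' : V' ⟶ Y := ObjectProperty.homMk c
    have hbc : b' ≫ f = c' ≫ g := by ext; exact hc
    refine h.strictEpi_of_comp hA (f := sq.lift b' c' hbc) (k := a) ?_ ((hA _).1 K.2).1
    rw [sq.lift_fst]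
    exact T₀
  · intro W X Y Z f g i j sq hg hg'
    obtain ⟨Q, q, δ, T⟩ := h.exists_tri_of_strictMono hA hg hg'
    obtain ⟨V, a, b, T'⟩ := distinguished_cocone_triangle₂ (δ ≫ f.hom⟦(1 : ℤ)⟧')
    obtain ⟨c, hc, -⟩ := complete_distinguished_triangle_morphism₂ _ _ T T' f.hom (𝟙 Q.obj)
      (show δ ≫ f.hom⟦(1 : ℤ)⟧' = 𝟙 Q.obj ≫ δ ≫ f.hom⟦(1 : ℤ)⟧' by simp)
    have T₀ : Tri a b := ⟨_, T'⟩
    let V' : A.FullSubcategory := ⟨V, (hA _).2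
      ⟨h.cut.up_ext T₀ ((hA _).1 X.2).1 ((hA _).1 Q.2).1,
        h.cut'.dn_ext T₀ ((hA _).1 X.2).2 ((hA _).1 Q.2).2⟩⟩
    let a' : X ⟶ V' := ObjectProperty.homMk a
    let c' : Y ⟶ V' := ObjectProperty.homMk c
    have hbc : f ≫ a' = g ≫ c' := by ext; exact hc.symm
    refine h.strictMono_of_comp hA (g := sq.desc a' c' hbc) (k := b) ?_ ((hA _).1 Q.2).2
    rw [sq.inl_desc]
    exact T₀

end IsThin

end Thin

/-! ### Chain conditions in terms of triangles, and their transfer between intervals. -/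

section Chains

variable {C : Type u} [Category.{v} C] [HasZeroObject C] [HasShift C ℤ] [Preadditive C]
  [∀ n : ℤ, (shiftFunctor C n).Additive] [Pretriangulated C]

/-- A presentation of `X` as an extension of objects satisfying `A`. -/
structure Sub (A : ObjectProperty C) (X : C) where
  /-- the subobject -/
  S : C
  /-- the quotient -/
  T : C
  /-- the inclusion -/
  i : S ⟶ X
  /-- the projection -/
  p : X ⟶ T
  tri : Tri i p
  hS : A S
  hT : A T

instance (A : ObjectProperty C) (X : C) : Preorder (Sub A X) where
  le s t := ∃ k : s.S ⟶ t.S, k ≫ t.i = s.i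
  le_refl s := ⟨𝟙 _, Category.id_comp _⟩
  le_trans := by
    rintro r s t ⟨k, hk⟩ ⟨l, hl⟩
    exact ⟨k ≫ l, by rw [Category.assoc, hl, hk]⟩

/-- The chain conditions on the subobjects, with quotient satisfying `A`, of the objects
satisfying `A`. -/
def ChainCond (A : ObjectProperty C) : Prop :=
  ∀ X, A X → WellFoundedGT (Sub A X) ∧ WellFoundedLT (Sub A X)

lemma ChainCond.exists_minimal {A : ObjectProperty C} (h : ChainCond A) {X : C} (hX : A X)
    (R : Sub A X → Prop) (hR : ∃ s, R s) : ∃ s, R s ∧ ∀ t, R t → t ≤ s → s ≤ t := by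
  have := (h X hX).2
  obtain ⟨s, hs, hs'⟩ := (wellFounded_lt (α := Sub A X)).has_min {s | R s} hR
  exact ⟨s, hs, fun t ht hts => not_lt_iff_not_le_or_ge.1 (hs' t ht) |>.resolve_left
    (not_not.2 hts)⟩

lemma ChainCond.exists_maximal {A : ObjectProperty C} (h : ChainCond A) {X : C} (hX : A X)
    (R : Sub A X → Prop) (hR : ∃ s, R s) : ∃ s, R s ∧ ∀ t, R t → s ≤ t → t ≤ s := by
  have := (h X hX).1
  obtain ⟨s, hs, hs'⟩ := (wellFounded_gt (α := Sub A X)).has_min {s | R s} hR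
  exact ⟨s, hs, fun t ht hts => not_lt_iff_not_le_or_ge.1 (hs' t ht) |>.resolve_left
    (not_not.2 hts)⟩

lemma strictMono_of_le_iff {α β : Type*} [Preorder α] [Preorder β] {f : α → β}
    (h : ∀ a b, f a ≤ f b ↔ a ≤ b) : StrictMono f := fun a b hab => by
  rw [lt_iff_le_not_ge] at hab ⊢
  rwa [h, h]

lemma wellFounded_of_le_iff {α β : Type*} [Preorder α] [Preorder β] {f : α → β}
    (h : ∀ a b, f a ≤ f b ↔ a ≤ b) (hβ : WellFoundedGT β ∧ WellFoundedLT β) :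
    WellFoundedGT α ∧ WellFoundedLT α := by
  obtain ⟨_, _⟩ := hβ
  exact ⟨(strictMono_of_le_iff h).wellFoundedGT, (strictMono_of_le_iff h).wellFoundedLT⟩

lemma ChainCond.mono {A B : ObjectProperty C} (h : ChainCond B) (hAB : A ≤ B) : ChainCond A :=
  fun X hX => wellFounded_of_le_iff
    (f := fun s : Sub A X => (⟨s.S, s.T, s.i, s.p, s.tri, hAB _ s.hS, hAB _ s.hT⟩ : Sub B X))
    (fun _ _ => Iff.rfl) (h X (hAB X hX))

lemma IsKer.iso_left {A : Type u} [Category.{v} A] [HasZeroMorphisms A] {X' X Y Z : A}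
    {f : X ⟶ Y} {g : Y ⟶ Z} (h : IsKer f g) (e : X' ≅ X) : IsKer (e.hom ≫ f) g where
  zero := by rw [Category.assoc, h.zero, comp_zero]
  mono := by
    have := h.mono
    infer_instance
  lift k hk := by
    obtain ⟨l, hl⟩ := h.lift k hk
    exact ⟨l ≫ e.inv, by simpa using hl⟩

lemma Slicing.interval_mono (P : Slicing C) {I J : Set ℝ} (h : I ⊆ J) :
    P.interval I ≤ P.interval J :=
  fun _ ⟨F, hF⟩ => ⟨F, fun i => h (hF i)⟩

variable [IsTriangulated C]

lemma IsThin.isLengthQuasiAbelian {U L U' L' A : ObjectProperty C} (h : IsThin U L U' L')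
    (hA : ∀ X, A X ↔ U X ∧ L' X) (hc : ChainCond A) : IsLengthQuasiAbelian A.FullSubcategory := by
  refine ⟨h.isQuasiAbelian hA, fun X => ?_⟩
  have := h.isQuasiAbelian hA
  have key (s : StrictSubobject X) : ∃ (Z : A.FullSubcategory) (g : X ⟶ Z),
      Tri s.1.arrow.hom g.hom := h.exists_tri_of_strictMono hA inferInstance s.2
  choose Z g T using key
  refine wellFounded_of_le_iff
    (f := fun s => (⟨_, _, _, _, T s, (s.1 : A.FullSubcategory).2, (Z s).2⟩ : Sub A X.obj))
    (fun s t => ?_) (hc X.obj X.2)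
  constructor
  · rintro ⟨k, hk⟩
    exact Subobject.le_of_comm (ObjectProperty.homMk k) (by ext; exact hk)
  · intro hst
    exact ⟨(Subobject.ofLE s.1 t.1 hst).hom, congrArg (·.hom) (Subobject.ofLE_arrow hst)⟩

namespace Slicing

variable (P : Slicing C)

lemma isThin {S T : Set ℝ} (hS : IsUpperSet S) (hT : IsUpperSet T) (hTS : T ⊆ S)
    (hST : ∀ x ∈ S, x + 1 ∈ T) : IsThin (P.up S) (P.dn S) (P.up T) (P.dn T) where
  cut := P.isCut hS
  cut' := P.isCut hT
  le _ := P.up_mono hTS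
  shift {X} hX := (P.up_shift X).2 (P.up_mono hST hX)

lemma isThin_Ioo {a b : ℝ} (hab : a < b) (hab' : b - a ≤ 1) :
    IsThin (P.up (Set.Ioi a)) (P.dn (Set.Ioi a)) (P.up (Set.Ici b)) (P.dn (Set.Ici b)) :=
  P.isThin (isUpperSet_Ioi a) (isUpperSet_Ici b) (fun x hx => hab.trans_le hx)
    fun x hx => by simp only [Set.mem_Ioi, Set.mem_Ici] at *; linarith

variable {P}

lemma HasLengthIntervals.chainCond {ζ : ℝ} (h : P.HasLengthIntervals ζ) {a b : ℝ}
    (hab : a < b) (hab' : b - a ≤ 1) (hζ : b - a ≤ 2 * ζ) :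
    ChainCond (P.interval (Set.Ioo a b)) := by
  intro X hX
  -- Centring the long interval at `a + ζ` makes the left ends agree. Then `b - a ≤ 1` suffices to
  -- see triangles in the short interval as kernels in the long one, which may itself be wider than
  -- 1.
  obtain ⟨hq, hl⟩ := h (a + ζ)
  have hle : P.interval (Set.Ioo a b) ≤ P.interval (Set.Ioo (a + ζ - ζ) (a + ζ + ζ)) :=
    P.interval_mono (Set.Ioo_subset_Ioo (by linarith) (by linarith))
  let B := P.interval (Set.Ioo (a + ζ - ζ) (a + ζ + ζ))
  have hB (Y : B.FullSubcategory) : P.up (Set.Ioi a) Y.obj := by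
    have := ((P.interval_Ioo_iff _ _ _).1 Y.2).1
    rwa [add_sub_cancel_right] at this
  let X' : B.FullSubcategory := ⟨X, hle X hX⟩
  let S (s : Sub (P.interval (Set.Ioo a b)) X) : B.FullSubcategory := ⟨s.S, hle _ s.hS⟩
  let T (s : Sub (P.interval (Set.Ioo a b)) X) : B.FullSubcategory := ⟨s.T, hle _ s.hT⟩
  let i (s) : S s ⟶ X' := ObjectProperty.homMk s.i
  let p (s) : X' ⟶ T s := ObjectProperty.homMk s.p
  have hker (s) : IsKer (i s) (p s) := by
    refine ⟨by ext; exact s.tri.zero, Preadditive.mono_of_cancel_zero _ fun {Y} k hk => ?_,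
      fun {Y} k hk => ?_⟩
    · ext
      exact (P.isThin_Ioo hab hab').cancel_right s.tri ((P.interval_Ioo_iff _ _ _).1 s.hT).2 (hB Y)
        (congrArg (·.hom) hk)
    · obtain ⟨l, hl⟩ := s.tri.lift k.hom (congrArg (·.hom) hk)
      exact ⟨ObjectProperty.homMk l, by ext; exact hl⟩
  have hmono (s) : Mono (i s) := (hker s).mono
  refine wellFounded_of_le_iff (f := fun s => (⟨Subobject.mk (i s), by
    rw [← Subobject.underlyingIso_hom_comp_eq_mk]
    exact ((hker s).iso_left _).isStrictHom⟩ : StrictSubobject X')) (fun s t => ?_) (hl X')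
  constructor
  · intro hst
    exact ⟨(Subobject.ofMkLEMk (i s) (i t) hst).hom,
      congrArg (·.hom) (Subobject.ofMkLEMk_comp (h := hst))⟩
  · rintro ⟨k, hk⟩
    exact Subobject.mk_le_mk_of_comm (ObjectProperty.homMk k) (by ext; exact hk)

lemma hasLengthIntervals_of_chainCond {η : ℝ} (h0 : 0 < η) (hη : 2 * η ≤ 1)
    (h : ∀ φ, ChainCond (P.interval (Set.Ioo (φ - η) (φ + η)))) : P.HasLengthIntervals η :=
  fun φ => (P.isThin_Ioo (by linarith) (by linarith)).isLengthQuasiAbelian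
    (fun X => P.interval_Ioo_iff _ _ X) (h φ)

lemma HasLengthIntervals.mono {ζ η : ℝ} (h : P.HasLengthIntervals ζ) (h0 : 0 < η) (hη : 2 * η ≤ 1)
    (hζ : η ≤ ζ) : P.HasLengthIntervals η :=
  hasLengthIntervals_of_chainCond h0 hη fun φ =>
    h.chainCond (by linarith) (by linarith) (by linarith)

end Slicing

end Chains

/-! ### From a real family of t-structures to a slicing. -/

section CutFamilies

variable {C : Type u} [Category.{v} C] [HasZeroObject C] [HasShift C ℤ] [Preadditive C]
  [∀ n : ℤ, (shiftFunctor C n).Additive] [Pretriangulated C]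

/-- A real family of bounded t-structures; `up t` and `dn t` play the role of the objects with
phases `> t` and `≤ t`. -/
structure IsCutFamily (up dn : ℝ → ObjectProperty C) : Prop where
  cut (t : ℝ) : IsCut (up t) (dn t)
  anti {s t : ℝ} (h : s ≤ t) : up t ≤ up s
  up_shift (t : ℝ) (X : C) : up (t + 1) (X⟦(1 : ℤ)⟧) ↔ up t X
  dn_shift (t : ℝ) (X : C) : dn (t + 1) (X⟦(1 : ℤ)⟧) ↔ dn t X
  right_continuous {t : ℝ} {X : C} (h : ∀ s, t < s → dn s X) : dn t X
  bounded (X : C) : ∃ s t, up s X ∧ dn t X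

namespace IsCutFamily

variable {up dn : ℝ → ObjectProperty C}

/-- The semistable objects of a family of t-structures. -/
def sem (up dn : ℝ → ObjectProperty C) (φ : ℝ) : ObjectProperty C :=
  fun X => (∀ t < φ, up t X) ∧ dn φ X

variable (D : IsCutFamily up dn)
include D

lemma mono {s t : ℝ} (h : s ≤ t) : dn s ≤ dn t := ((D.cut t).le_iff (D.cut s)).1 (D.anti h)

lemma isThin {s t : ℝ} (h : s ≤ t) (h' : t ≤ s + 1) : IsThin (up s) (dn s) (up t) (dn t) where
  cut := D.cut s
  cut' := D.cut t
  le := D.anti h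
  shift hX := D.anti h' _ ((D.up_shift _ _).2 hX)

variable [IsTriangulated C]

/-- In a thin piece of a family of t-structures, nonzero objects have a semistable subobject of
maximal phase. -/
lemma exists_top {a b w : ℝ} {A : ObjectProperty C} (hA : ∀ X, A X ↔ up a X ∧ dn b X)
    (hc : ChainCond A) (hab : a ≤ b) (hab' : b ≤ a + 1) (hwb : w ≤ b) {X : C} (hX : A X)
    (hX₀ : ¬ IsZero X) (hw : dn w X) :
    ∃ (s : Sub A X) (φ t : ℝ), ¬ IsZero s.S ∧ sem up dn φ s.S ∧ φ ≤ w ∧ a ≤ t ∧ t < φ ∧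
      dn t s.T := by
  have th := D.isThin hab hab'
  have h0 : A 0 := (hA _).2 ⟨(D.cut a).up_zero (isZero_zero C), (D.cut b).dn_zero (isZero_zero C)⟩
  -- Minimality is what makes `s.S` semistable. Its phase will be the supremum of the `t` with `s.S`
  -- in `up t`.
  obtain ⟨s, ⟨hs, t₁, hat₁, hup, hdn⟩, hmin⟩ := hc.exists_minimal hX
    (fun s => ¬ IsZero s.S ∧ ∃ t, a ≤ t ∧ up t s.S ∧ dn t s.T)
    ⟨⟨X, 0, _, 0, Tri.of_isZero_right (isZero_zero C) (Iso.refl X) 0, hX, h0⟩, hX₀, a, le_rfl,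
      ((hA _).1 hX).1, (D.cut a).dn_zero (isZero_zero C)⟩
  have hne {t : ℝ} (h : up t s.S) (h' : dn t s.S) : False := hs ((D.cut t).isZero h h')
  have hmax : dn (max w t₁) s.S :=
    (D.isThin le_rfl (by linarith)).dn_fiber s.tri (D.mono (le_max_left _ _) _ hw)
      (D.mono (le_max_right _ _) _ hdn)
  have ht₁ : t₁ < w := by
    by_contra! h
    rw [max_eq_right h] at hmax
    exact hne hup hmax
  rw [max_eq_left ht₁.le] at hmax
  have hbdd : ∀ t ∈ {t | up t s.S}, t ≤ w := fun t ht => by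
    by_contra! h
    exact hne (D.anti h.le _ ht) hmax
  have hφ₁ : t₁ ≤ sSup {t | up t s.S} := le_csSup ⟨w, hbdd⟩ hup
  have hφup : ∀ t < sSup {t | up t s.S}, up t s.S := fun t ht => by
    obtain ⟨r, hr, htr⟩ := exists_lt_of_lt_csSup ⟨t₁, hup⟩ ht
    exact D.anti htr.le _ hr
  have hφdn : dn (sSup {t | up t s.S}) s.S := by
    refine D.right_continuous fun t ht => ?_
    rcases le_or_gt w t with h | h
    · exact D.mono h _ hmax
    -- If the part `K` of `s.S` above `t` were nonzero, it would be a competitor for `s`. By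
    -- minimality `K ⟶ s.S` would then have a section, so `s.S` would lie in `up t` with `t` beyond
    -- the supremum.
    obtain ⟨K, Q, k, q, T, hK, hQ⟩ := (D.cut t).exists_tri s.S
    by_cases hK₀ : IsZero K
    · have := T.isIso_of_isZero_left hK₀
      exact (D.cut t).dn_iso (asIso q).symm hQ
    exfalso
    obtain ⟨T', p', hT'⟩ := exists_cone (k ≫ s.i)
    obtain ⟨m, n, TT, -, -⟩ := T.octahedron s.tri hT'
    have hKA : A K := (hA _).2 ⟨D.anti (by linarith) _ hK,
      th.dn_fiber T ((hA _).1 s.hS).2 (D.mono (by linarith) _ hQ)⟩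
    have hTt : dn t T' := (D.cut t).dn_ext TT hQ (D.mono (by linarith) _ hdn)
    have hTA : A T' := (hA _).2 ⟨th.up_cone hT' ((hA _).1 hKA).1 ((hA _).1 hX).1,
      D.mono (by linarith) _ hTt⟩
    obtain ⟨r, hr⟩ := hmin ⟨K, T', _, _, hT', hKA, hTA⟩ ⟨hK₀, t, by linarith, hK, hTt⟩ ⟨k, rfl⟩
    have hr' : (r ≫ k - 𝟙 s.S) ≫ s.i = 0 := by
      rw [Preadditive.sub_comp, Category.assoc, Category.id_comp, sub_eq_zero]
      exact hr
    have hr'' := th.cancel_right s.tri ((hA _).1 s.hT).2 ((hA _).1 s.hS).1 hr'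
    exact absurd (le_csSup ⟨w, hbdd⟩ ((D.cut t).up_retract (sub_eq_zero.1 hr'') hK)) (not_le.2 ht)
  refine ⟨s, sSup {t | up t s.S}, t₁, hs, ⟨hφup, hφdn⟩, csSup_le ⟨t₁, hup⟩ hbdd, hat₁,
    lt_of_le_of_ne hφ₁ fun h => hne hup (by rwa [h]), hdn⟩

/-- Take a maximal subobject that is already filtered with phases above those of its quotient. If
the quotient is nonzero, pulling back its top semistable subobject from `exists_top` gives a
strictly larger one. -/
lemma exists_hasHN_thin {a b : ℝ} {A : ObjectProperty C} (hA : ∀ X, A X ↔ up a X ∧ dn b X)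
    (hc : ChainCond A) (hab : a ≤ b) (hab' : b ≤ a + 1) {X : C} (hX : A X) :
    ∃ l, HasHN (sem up dn) l X ∧ ∀ φ ∈ l, a < φ ∧ φ ≤ b := by
  have th := D.isThin hab hab'
  have h0 : A 0 := (hA _).2 ⟨(D.cut a).up_zero (isZero_zero C), (D.cut b).dn_zero (isZero_zero C)⟩
  obtain ⟨s, ⟨w, haw, hwb, hw, l, hl, hl'⟩, hmax⟩ := hc.exists_maximal hX
    (fun s => ∃ w, a ≤ w ∧ w ≤ b ∧ dn w s.T ∧ ∃ l, HasHN (sem up dn) l s.S ∧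
      ∀ φ ∈ l, w < φ ∧ φ ≤ b)
    ⟨⟨0, X, 0, _, Tri.of_isZero_left (isZero_zero C) 0 (Iso.refl X), h0, hX⟩, b, hab, le_rfl,
      ((hA _).1 hX).2, [], .nil (isZero_zero C), by simp⟩
  by_cases hT : IsZero s.T
  · have := s.tri.isIso_of_isZero_right hT
    exact ⟨l, hl.iso (asIso s.i), fun φ hφ => ⟨haw.trans_lt (hl' φ hφ).1, (hl' φ hφ).2⟩⟩
  exfalso
  obtain ⟨r, φ, t, hr, hφ, hφw, hat, htφ, ht⟩ := D.exists_top hA hc hab hab' hwb s.hT hT hw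
  obtain ⟨S', i', T'⟩ := exists_fiber (s.p ≫ r.p)
  obtain ⟨m, n, TT, hm, hn⟩ := s.tri.octahedron' r.tri T'
  have hS' : A S' := (hA _).2 ⟨(D.cut a).up_ext TT ((hA _).1 s.hS).1 ((hA _).1 r.hS).1,
    (D.cut b).dn_ext TT ((hA _).1 s.hS).2 ((hA _).1 r.hS).2⟩
  obtain ⟨k, hk⟩ := hmax ⟨S', r.T, i', _, T', hS', r.hT⟩ ⟨t, hat, by linarith, ht, [φ] ++ l,
    (HasHN.singleton hφ hr).append hl TT fun ψ hψ χ hχ => by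
      obtain rfl : ψ = φ := by simpa using hψ
      exact hφw.trans_lt (hl' χ hχ).1, fun ψ hψ => by
      rcases List.mem_append.1 hψ with hψ | hψ
      · obtain rfl : ψ = φ := by simpa using hψ
        exact ⟨htφ, hφw.trans hwb⟩
      · have := hl' ψ hψ
        exact ⟨by linarith, this.2⟩⟩ ⟨m, hm⟩
  have hn₀ : n = 0 := by
    refine th.cancel_right r.tri ((hA _).1 r.hT).2 ((hA _).1 hS').1 (hn.trans ?_)
    have hk' : k ≫ s.i = i' := hk
    rw [← hk', Category.assoc, s.tri.zero, comp_zero]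
  refine hr ((IsZero.iff_id_eq_zero _).2 ?_)
  exact th.cancel_left TT ((hA _).1 s.hS).1 ((hA _).1 r.hS).2 (by rw [hn₀, zero_comp])

/-- A bounded object is cut into finitely many slabs of width `δ`, each filtered by the thin case;
their filtrations are concatenated. -/
lemma exists_hasHN {δ : ℝ} (hδ : 0 < δ) (hδ' : δ ≤ 1)
    (hc : ∀ t, ChainCond (fun X => up t X ∧ dn (t + δ) X)) (X : C) :
    ∃ l, HasHN (sem up dn) l X := by
  have key (n : ℕ) : ∀ (a b : ℝ) (_ : b ≤ a + n * δ) (X : C), up a X → dn b X →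
      ∃ l, HasHN (sem up dn) l X ∧ ∀ φ ∈ l, a < φ ∧ φ ≤ b := by
    induction n with
    | zero =>
      intro a b hab X hX hX'
      exact ⟨[], .nil ((D.cut a).isZero hX (D.mono (by simpa using hab) _ hX')), by simp⟩
    | succ n ih =>
      intro a b hab X hX hX'
      rcases le_or_gt b a with h | h
      · exact ⟨[], .nil ((D.cut a).isZero hX (D.mono h _ hX')), by simp⟩
      rcases le_or_gt b (a + δ) with h' | h'
      · exact D.exists_hasHN_thin (fun _ => Iff.rfl)
          ((hc a).mono fun Y hY => ⟨hY.1, D.mono h' _ hY.2⟩) h.le (by linarith) ⟨hX, hX'⟩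
      obtain ⟨K, Q, k, q, T, hK, hQ⟩ := (D.cut (a + δ)).exists_tri X
      obtain ⟨l, hl, hl'⟩ := ih (a + δ) b (by push_cast at hab; linarith) K hK
        ((D.isThin le_rfl (by linarith)).dn_fiber T hX' (D.mono h'.le _ hQ))
      obtain ⟨r, hr, hr'⟩ := D.exists_hasHN_thin (X := Q) (fun _ => Iff.rfl) (hc a) (by linarith)
        (by linarith) ⟨(D.isThin le_rfl (by linarith)).up_cone T
          (D.anti (by linarith) _ hK) hX, hQ⟩
      refine ⟨r ++ l, hr.append hl T fun ψ hψ φ hφ => (hr' ψ hψ).2.trans_lt (hl' φ hφ).1,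
        fun φ hφ => ?_⟩
      rcases List.mem_append.1 hφ with hφ | hφ
      · have := hr' φ hφ
        exact ⟨this.1, by linarith⟩
      · have := hl' φ hφ
        exact ⟨by linarith, this.2⟩
  obtain ⟨s, t, hs, ht⟩ := D.bounded X
  obtain ⟨n, hn⟩ := exists_nat_ge ((t - s) / δ)
  obtain ⟨l, hl, -⟩ := key n s t (by rw [div_le_iff₀ hδ] at hn; linarith) X hs ht
  exact ⟨l, hl⟩

/-- The slicing of a family of t-structures satisfying a local chain condition. -/
def slicing {δ : ℝ} (hδ : 0 < δ) (hδ' : δ ≤ 1)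
    (hc : ∀ t, ChainCond (fun X => up t X ∧ dn (t + δ) X)) : Slicing C where
  sem := sem up dn
  sem_of_iso φ _ _ e h := ⟨fun t ht => (D.cut t).up_iso e (h.1 t ht), (D.cut φ).dn_iso e h.2⟩
  sem_zero φ := ⟨fun t _ => (D.cut t).up_zero (isZero_zero C), (D.cut φ).dn_zero (isZero_zero C)⟩
  sem_biprod φ _ _ h h' := ⟨fun t ht => (D.cut t).up_biprod (h.1 t ht) (h'.1 t ht),
    (D.cut φ).dn_biprod h.2 h'.2⟩
  sem_shift φ X := by
    refine and_congr ⟨fun h t ht => (D.up_shift t X).1 (h (t + 1) (by linarith)),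
      fun h t ht => ?_⟩ (D.dn_shift φ X)
    have := (D.up_shift (t - 1) X).2 (h (t - 1) (by linarith))
    rwa [sub_add_cancel] at this
  hom_eq_zero {φ ψ} h _ _ hX hY f := (D.cut ψ).hom_zero (hX.1 ψ h) hY.2 f
  exists_hn X _ := by
    obtain ⟨l, hl⟩ := D.exists_hasHN hδ hδ' hc X
    exact ⟨hl.exists_filtration.choose⟩

end IsCutFamily

end CutFamilies

/-! ### Gluing torsion pairs of N and C/N. -/

section Gluing

variable {C : Type u} [Category.{v} C] [HasZeroObject C] [HasShift C ℤ] [Preadditive C]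
  [∀ n : ℤ, (shiftFunctor C n).Additive] [Pretriangulated C]

lemma Tri.cone_iso {X Y Z Z' : C} {f : X ⟶ Y} {g : Y ⟶ Z} {g' : Y ⟶ Z'} (T : Tri f g)
    (T' : Tri f g') : Nonempty (Z ≅ Z') := by
  obtain ⟨h, H⟩ := T
  obtain ⟨h', H'⟩ := T'
  exact ⟨Triangle.π₃.mapIso (isoTriangleOfIso₁₂ _ _ H H' (Iso.refl _) (Iso.refl _)
    ((Category.comp_id _).trans (Category.id_comp _).symm))⟩

variable {N : ObjectProperty C}

lemma trW_of_tri_right {X Y Z : C} {f : X ⟶ Y} {g : Y ⟶ Z} (T : Tri f g) (hZ : N Z) :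
    N.trW f := by
  obtain ⟨h, H⟩ := T
  exact ⟨_, _, _, H, hZ⟩

lemma isIso_map_left {X Y Z : C} {f : X ⟶ Y} {g : Y ⟶ Z} (T : Tri f g) (hZ : N Z) :
    IsIso (N.trW.Q.map f) :=
  Localization.inverts N.trW.Q N.trW f (trW_of_tri_right T hZ)

variable [N.IsTriangulated]

lemma ext_mem [N.IsClosedUnderIsomorphisms] {X Y Z : C} {f : X ⟶ Y} {g : Y ⟶ Z} (T : Tri f g)
    (hX : N X) (hZ : N Z) : N Y := by
  obtain ⟨h, H⟩ := T
  exact N.ext_of_isTriangulatedClosed₂ _ H hX hZ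

lemma isIso_map_right {X Y Z : C} {f : X ⟶ Y} {g : Y ⟶ Z} (T : Tri f g) (hX : N X) :
    IsIso (N.trW.Q.map g) := by
  obtain ⟨h, T'⟩ := T.rot
  exact isIso_map_left T' (N.le_shift 1 _ hX)

variable [IsTriangulated C]

/-- By calculus of fractions `f` is killed by some `s` with cone in `N`, and so factors through that
cone. -/
lemma exists_factor_of_map_eq_zero {X Y : C} (f : X ⟶ Y) (hf : N.trW.Q.map f = 0) :
    ∃ (n : N.FullSubcategory) (a : X ⟶ n.obj) (b : n.obj ⟶ Y), a ≫ b = f := by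
  obtain ⟨W, s, ⟨Z, g, h, H, hZ⟩, hs'⟩ := (MorphismProperty.map_eq_iff_precomp N.trW.Q N.trW f 0).1
    (by rw [hf, Functor.map_zero])
  rw [comp_zero] at hs'
  obtain ⟨l, hl⟩ := Tri.desc ⟨h, H⟩ f hs'
  exact ⟨⟨Z, hZ⟩, g, l, hl⟩

/-- If the identity of `X` dies in the quotient it factors through `N`, making `X` a direct summand
of an object of `N`; this is where thickness enters. -/
lemma isZero_Q_obj_iff [N.IsStableUnderRetracts] {X : C} : IsZero (N.trW.Q.obj X) ↔ N X := by
  constructor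
  · intro hX
    obtain ⟨n, a, b, hab⟩ := exists_factor_of_map_eq_zero (N := N) (𝟙 X) (hX.eq_of_src _ _)
    exact N.prop_of_retract ⟨a, b, hab⟩ n.2
  · intro hX
    have := isIso_map_left (N := N) (Tri.of_isZero_left (isZero_zero C) 0 (Iso.refl X)) hX
    exact (N.trW.Q.map_isZero (isZero_zero C)).of_iso (asIso (N.trW.Q.map (0 : 0 ⟶ X))).symm

/-- The left part of the torsion pair obtained by gluing torsion pairs of `N` and `C/N`. -/
def glueUp (V' : ObjectProperty (VerdierQuotient N)) (M : ObjectProperty N.FullSubcategory) :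
    ObjectProperty C :=
  fun X => V' (N.trW.Q.obj X) ∧ ∀ n, M n → ∀ f : X ⟶ n.obj, f = 0

/-- The right part of the torsion pair obtained by gluing torsion pairs of `N` and `C/N`. -/
def glueDn (M' : ObjectProperty (VerdierQuotient N)) (V : ObjectProperty N.FullSubcategory) :
    ObjectProperty C :=
  fun X => M' (N.trW.Q.obj X) ∧ ∀ n, V n → ∀ f : n.obj ⟶ X, f = 0

/-- Torsion pairs of `C`, `N` and `C/N` for which the pairs of `N` and `C/N` are close to being
compatible with those of `C`. -/
structure IsGlueDatum (U L U' L' : ObjectProperty C) (V M : ObjectProperty N.FullSubcategory)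
    (V' M' : ObjectProperty (VerdierQuotient N)) : Prop where
  thin : IsThin U L U' L'
  cutN : IsCut V M
  cutQ : IsCut V' M'
  up_Q {X : C} : U' X → V' (N.trW.Q.obj X)
  dn_Q {X : C} : L X → M' (N.trW.Q.obj X)
  up_obj {n : N.FullSubcategory} : V n → U n.obj
  dn_obj {n : N.FullSubcategory} : M n → L' n.obj
  up_N {n : N.FullSubcategory} : U' n.obj → V n
  dn_N {n : N.FullSubcategory} : L n.obj → M n
  mem_of_up {X K R : C} {k : K ⟶ X} {q : X ⟶ R} (T : Tri k q) (hX : V' (N.trW.Q.obj X))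
    (hK : U K) (hR : L R) : N R
  mem_of_dn {X K R : C} {k : K ⟶ X} {q : X ⟶ R} (T : Tri k q) (hX : M' (N.trW.Q.obj X))
    (hK : U' K) (hR : L' R) : N K

namespace IsGlueDatum

variable {U L U' L' : ObjectProperty C} {V M : ObjectProperty N.FullSubcategory}
    {V' M' : ObjectProperty (VerdierQuotient N)} (G : IsGlueDatum U L U' L' V M V' M')
include G

lemma up_ext {X Y Z : C} {f : X ⟶ Y} {g : Y ⟶ Z} (T : Tri f g) (hX : glueUp V' M X)
    (hZ : glueUp V' M Z) : glueUp V' M Y := by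
  refine ⟨G.cutQ.up_ext (T.map N.trW.Q) hX.1 hZ.1, fun n hn k => ?_⟩
  obtain ⟨l, rfl⟩ := T.desc k (hX.2 n hn _)
  rw [hZ.2 n hn l, comp_zero]

lemma dn_ext {X Y Z : C} {f : X ⟶ Y} {g : Y ⟶ Z} (T : Tri f g) (hX : glueDn M' V X)
    (hZ : glueDn M' V Z) : glueDn M' V Y := by
  refine ⟨G.cutQ.dn_ext (T.map N.trW.Q) hX.1 hZ.1, fun n hn k => ?_⟩
  obtain ⟨l, rfl⟩ := T.lift k (hZ.2 n hn _)
  rw [hX.2 n hn l, zero_comp]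

lemma hom_eq_zero_of_N {m n : N.FullSubcategory} (hm : V m) (hn : M n) (f : m.obj ⟶ n.obj) :
    f = 0 :=
  congrArg (·.hom) (G.cutN.hom_zero hm hn (ObjectProperty.homMk f))

lemma hom_eq_zero {X Y : C} (hX : glueUp V' M X) (hY : glueDn M' V Y) (f : X ⟶ Y) : f = 0 := by
  obtain ⟨n, a, b, rfl⟩ := exists_factor_of_map_eq_zero (N := N) f (G.cutQ.hom_zero hX.1 hY.1 _)
  obtain ⟨K, R, k, q, T, hK, hR⟩ := G.cutN.exists_tri n
  obtain ⟨l, hl⟩ := (T.map N.ι).lift a (hX.2 R hR _)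
  rw [← hl, Category.assoc, hY.2 K hK (N.ι.map k ≫ b), comp_zero]

lemma up_le : U' ≤ glueUp V' M := fun _ hX =>
  ⟨G.up_Q hX, fun _ hn f => G.thin.cut'.hom_zero hX (G.dn_obj hn) f⟩

lemma dn_le : L ≤ glueDn M' V := fun _ hX =>
  ⟨G.dn_Q hX, fun _ hn f => G.thin.cut.hom_zero (G.up_obj hn) hX f⟩

/-- The `L`-part `R` of `X` lies in `N` and then in `M`, so `X ⟶ R` vanishes and `X` is a retract of
its `U`-part. -/
lemma le_up : glueUp V' M ≤ U := fun X hX => by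
  obtain ⟨K, R, k, q, T, hK, hR⟩ := G.thin.cut.exists_tri X
  have hRN := G.mem_of_up T hX.1 hK hR
  obtain ⟨s, hs⟩ := T.exists_retract_mid (hX.2 ⟨R, hRN⟩ (G.dn_N hR) q)
  exact G.thin.cut.up_retract hs hK

lemma le_dn : glueDn M' V ≤ L' := fun X hX => by
  obtain ⟨K, R, k, q, T, hK, hR⟩ := G.thin.cut'.exists_tri X
  have hKN := G.mem_of_dn T hX.1 hK hR
  obtain ⟨s, hs⟩ := T.exists_section_mid (hX.2 ⟨K, hKN⟩ (G.up_N hK) k)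
  exact G.thin.cut'.dn_retract hs hR

variable {A : ObjectProperty C} (hA : ∀ X, A X ↔ U X ∧ L' X)
include hA

lemma exists_sub {E : C} (hE : A E) :
    ∃ s : Sub A E, V' (N.trW.Q.obj s.S) ∧ M' (N.trW.Q.obj s.T) := by
  obtain ⟨x, y, f, g, T, hx, hy⟩ := G.cutQ.exists_tri (N.trW.Q.obj E)
  let e := N.trW.Q.objObjPreimageIso x
  -- The map to `E` is represented by a fraction. Its source is trimmed to `K` in `U` and the cone
  -- of `K ⟶ E` to `B'` in `L'`; both corrections are by objects of `N`, so the image in the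
  -- quotient is unchanged.
  obtain ⟨φ, hφ⟩ := Localization.exists_rightFraction N.trW.Q N.trW (e.hom ≫ f)
  have hs : IsIso (N.trW.Q.map φ.s) := Localization.inverts N.trW.Q N.trW _ φ.hs
  have hfac : N.trW.Q.map φ.s ≫ e.hom ≫ f = N.trW.Q.map φ.f := by
    rw [hφ, MorphismProperty.RightFraction.map_s_comp_map]
  have hx' : V' (N.trW.Q.obj φ.X') := G.cutQ.up_iso (asIso (N.trW.Q.map φ.s) ≪≫ e).symm hx
  have T₁ : Tri (N.trW.Q.map φ.f) g := by
    rw [← hfac, ← Category.assoc]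
    exact T.iso_left (asIso (N.trW.Q.map φ.s) ≪≫ e)
  obtain ⟨K, R, k, q, TK, hK, hR⟩ := G.thin.cut.exists_tri φ.X'
  have hRN := G.mem_of_up TK hx' hK hR
  have hk : IsIso (N.trW.Q.map k) := isIso_map_left TK hRN
  obtain ⟨B, b, TB⟩ := exists_cone (k ≫ φ.f)
  have hKQ : V' (N.trW.Q.obj K) := G.cutQ.up_iso (asIso (N.trW.Q.map k)).symm hx'
  have hBQ : M' (N.trW.Q.obj B) := by
    have h₁ := TB.map N.trW.Q
    have h₂ := T₁.iso_left (asIso (N.trW.Q.map k))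
    rw [Functor.map_comp] at h₁
    obtain ⟨i⟩ := h₁.cone_iso h₂
    exact G.cutQ.dn_iso i.symm hy
  obtain ⟨n, B', a, c, Tn, hn, hB'⟩ := G.thin.cut'.exists_tri B
  have hnN := G.mem_of_dn Tn hBQ hn hB'
  obtain ⟨K', k', TK'⟩ := exists_fiber (b ≫ c)
  obtain ⟨i, j, TT, -, -⟩ := TB.octahedron' Tn TK'
  have : IsIso (N.trW.Q.map i) := isIso_map_left TT hnN
  have : IsIso (N.trW.Q.map c) := isIso_map_right Tn hnN
  have hn' := G.thin.le _ hn
  refine ⟨⟨K', B', k', b ≫ c, TK', (hA _).2 ⟨G.thin.cut.up_ext TT hK hn',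
    G.thin.dn_fiber TK' ((hA _).1 hE).2 hB'⟩, (hA _).2 ⟨G.thin.up_cone Tn hn'
      (G.thin.up_cone TB hK ((hA _).1 hE).1), hB'⟩⟩,
    G.cutQ.up_iso (asIso (N.trW.Q.map i)) hKQ, G.cutQ.dn_iso (asIso (N.trW.Q.map c)) hBQ⟩

variable [N.IsStableUnderRetracts]

/-- A morphism from the subobject to an object of `M` is removed by shrinking the subobject. -/
lemma exists_le {E : C} (s : Sub A E) (hS : V' (N.trW.Q.obj s.S)) (hT : M' (N.trW.Q.obj s.T))
    {n : N.FullSubcategory} (hn : M n) (g : s.S ⟶ n.obj) :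
    ∃ t : Sub A E, V' (N.trW.Q.obj t.S) ∧ M' (N.trW.Q.obj t.T) ∧ t ≤ s ∧ (s ≤ t → g = 0) := by
  obtain ⟨F, c, TF⟩ := exists_fiber g
  have : IsIso (N.trW.Q.map c) := isIso_map_left TF n.2
  -- The fiber of `g` need not lie in `U`, so it is replaced by its `U`-part `K`. The error `r` is
  -- in `M`, hence the cone `n'` of `K ⟶ s.S`, an extension of `n` by `r`, is still in `M`.
  obtain ⟨K, r, e, q, T, hK, hr⟩ := G.thin.cut.exists_tri F
  have hrN := G.mem_of_up T (G.cutQ.up_iso (asIso (N.trW.Q.map c)).symm hS) hK hr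
  obtain ⟨n', d, Tn⟩ := exists_cone (e ≫ c)
  obtain ⟨a, b, TT, -, hdb⟩ := T.octahedron TF Tn
  have hn'N : N n' := ext_mem TT hrN n.2
  have hn'M : M ⟨n', hn'N⟩ := by
    refine (G.cutN.dn_iff _).2 fun v hv f => ?_
    have hf : f.hom ≫ b = 0 := G.hom_eq_zero_of_N hv hn _
    obtain ⟨l, hl⟩ := TT.lift f.hom hf
    have hl₀ : l = 0 := G.hom_eq_zero_of_N (n := ⟨r, hrN⟩) hv (G.dn_N hr) l
    ext
    change f.hom = 0
    rw [← hl, hl₀, zero_comp]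
  have hn'L : L' n' := G.dn_obj hn'M
  have hn'U : U n' := G.thin.up_cone Tn hK ((hA _).1 s.hS).1
  have hKA : A K := (hA _).2 ⟨hK, G.thin.dn_fiber Tn ((hA _).1 s.hS).2 hn'L⟩
  obtain ⟨B, p, TB⟩ := exists_cone ((e ≫ c) ≫ s.i)
  obtain ⟨x, y, Txy, -, -⟩ := Tn.octahedron s.tri TB
  have hB : A B := (hA _).2 ⟨G.thin.cut.up_ext Txy hn'U ((hA _).1 s.hT).1,
    G.thin.cut'.dn_ext Txy hn'L ((hA _).1 s.hT).2⟩
  have : IsIso (N.trW.Q.map (e ≫ c)) := isIso_map_left Tn hn'N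
  have : IsIso (N.trW.Q.map y) := isIso_map_right Txy hn'N
  refine ⟨⟨K, B, _, p, TB, hKA, hB⟩, G.cutQ.up_iso (asIso (N.trW.Q.map (e ≫ c))).symm hS,
    G.cutQ.dn_iso (asIso (N.trW.Q.map y)).symm hT, ⟨e ≫ c, rfl⟩, ?_⟩
  rintro ⟨k, hk⟩
  -- If `s ≤ t`, then `K ⟶ s.S` has a section; its composite with `g` is zero, whence `g = 0`.
  have hk' : (k ≫ e ≫ c - 𝟙 s.S) ≫ s.i = 0 := by
    rw [Preadditive.sub_comp, Category.id_comp, sub_eq_zero, Category.assoc]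
    exact hk
  have hk'' := sub_eq_zero.1
    (G.thin.cancel_right s.tri ((hA _).1 s.hT).2 ((hA _).1 s.hS).1 hk')
  have hg : (k ≫ e ≫ c) ≫ g = k ≫ e ≫ c ≫ g := by simp
  rw [← Category.id_comp g, ← hk'', hg, TF.zero, comp_zero, comp_zero]

/-- A morphism from an object of `V` to the quotient is removed by enlarging the subobject. -/
lemma exists_ge {E : C} (s : Sub A E) (hS : glueUp V' M s.S) (hT : M' (N.trW.Q.obj s.T))
    {n : N.FullSubcategory} (hn : V n) (g : n.obj ⟶ s.T) :
    ∃ t : Sub A E, glueUp V' M t.S ∧ M' (N.trW.Q.obj t.T) ∧ s ≤ t ∧ (t ≤ s → g = 0) := by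
  obtain ⟨F, c, TF⟩ := exists_cone g
  have : IsIso (N.trW.Q.map c) := isIso_map_right TF n.2
  -- Dually, the cone of `g` is cut down to `B` in `L'`. The fiber `n'` of `s.T ⟶ B` is an extension
  -- of objects of `V`, so the new subobject, an extension of `n'` by `s.S`, stays in `glueUp`.
  obtain ⟨r, B, q, e, T, hr, hB⟩ := G.thin.cut'.exists_tri F
  have hrN := G.mem_of_dn T (G.cutQ.dn_iso (asIso (N.trW.Q.map c)) hT) hr hB
  obtain ⟨n', d, Tn⟩ := exists_fiber (c ≫ e)
  obtain ⟨a, b, TT, had, -⟩ := TF.octahedron' T Tn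
  have hn'N : N n' := ext_mem TT n.2 hrN
  have hn'V : V ⟨n', hn'N⟩ := by
    refine (G.cutN.up_iff _).2 fun v hv f => ?_
    have hf : a ≫ f.hom = 0 := G.hom_eq_zero_of_N hn hv _
    obtain ⟨l, hl⟩ := TT.desc f.hom hf
    have hl₀ : l = 0 := G.hom_eq_zero_of_N (m := ⟨r, hrN⟩) (G.up_N hr) hv l
    ext
    change f.hom = 0
    rw [← hl, hl₀, comp_zero]
  have hn'U : U n' := G.up_obj hn'V
  have hn'L : L' n' := G.thin.dn_fiber Tn ((hA _).1 s.hT).2 hB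
  have hBA : A B := (hA _).2 ⟨G.thin.up_cone Tn hn'U ((hA _).1 s.hT).1, hB⟩
  obtain ⟨K, k, TK⟩ := exists_fiber (s.p ≫ c ≫ e)
  obtain ⟨x, y, Txy, hx, hy⟩ := s.tri.octahedron' Tn TK
  have hK : A K := (hA _).2 ⟨G.thin.cut.up_ext Txy ((hA _).1 s.hS).1 hn'U,
    G.thin.cut'.dn_ext Txy ((hA _).1 s.hS).2 hn'L⟩
  have : IsIso (N.trW.Q.map (c ≫ e)) := isIso_map_right Tn hn'N
  have : IsIso (N.trW.Q.map x) := isIso_map_left Txy hn'N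
  refine ⟨⟨K, B, k, _, TK, hK, hBA⟩, ⟨G.cutQ.up_iso (asIso (N.trW.Q.map x)) hS.1,
    fun m hm f => ?_⟩, G.cutQ.dn_iso (asIso (N.trW.Q.map (c ≫ e))) hT, ⟨x, hx⟩, ?_⟩
  · obtain ⟨l, rfl⟩ := Txy.desc f (hS.2 m hm _)
    rw [G.hom_eq_zero_of_N (m := ⟨n', hn'N⟩) hn'V hm l, comp_zero]
  rintro ⟨l, hl⟩
  have hl' : l ≫ s.i = k := hl
  have hy₀ : y = 0 := by
    refine G.thin.cancel_right Tn hB ((hA _).1 hK).1 ?_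
    rw [hy, ← hl', Category.assoc, s.tri.zero, comp_zero]
  have hid : 𝟙 n' = 0 := G.thin.cancel_left Txy ((hA _).1 s.hS).1 hn'L (by rw [hy₀, zero_comp])
  rw [← had, ← Category.id_comp d, hid, zero_comp, comp_zero]

lemma exists_tri_of_mem (hc : ChainCond A) {E : C} (hE : A E) :
    ∃ (K R : C) (k : K ⟶ E) (q : E ⟶ R), Tri k q ∧ glueUp V' M K ∧ glueDn M' V R := by
  obtain ⟨s, ⟨hs, hs'⟩, hmin⟩ := hc.exists_minimal hE
    (fun s => V' (N.trW.Q.obj s.S) ∧ M' (N.trW.Q.obj s.T)) (G.exists_sub hA hE)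
  obtain ⟨t, ⟨ht, ht'⟩, hmax⟩ := hc.exists_maximal hE
    (fun s => glueUp V' M s.S ∧ M' (N.trW.Q.obj s.T)) ⟨s, ⟨hs, fun n hn g => by
      obtain ⟨r, hr, hr', hle, h⟩ := G.exists_le hA s hs hs' hn g
      exact h (hmin r ⟨hr, hr'⟩ hle)⟩, hs'⟩
  refine ⟨t.S, t.T, t.i, t.p, t.tri, ht, ht', fun n hn g => ?_⟩
  obtain ⟨r, hr, hr', hle, h⟩ := G.exists_ge hA t ht ht' hn g
  exact h (hmax r ⟨hr, hr'⟩ hle)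

lemma isCut (hc : ChainCond A) : IsCut (glueUp V' M) (glueDn M' V) where
  hom_zero := G.hom_eq_zero
  up_retract {X Y i r} h hY := by
    refine ⟨G.cutQ.up_retract (i := N.trW.Q.map i) (r := N.trW.Q.map r) ?_ hY.1, fun n hn f => ?_⟩
    · rw [← Functor.map_comp, h, CategoryTheory.Functor.map_id]
    · rw [← Category.id_comp f, ← h, Category.assoc, hY.2 n hn (r ≫ f), comp_zero]
  dn_retract {X Y i r} h hY := by
    refine ⟨G.cutQ.dn_retract (i := N.trW.Q.map i) (r := N.trW.Q.map r) ?_ hY.1, fun n hn f => ?_⟩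
    · rw [← Functor.map_comp, h, CategoryTheory.Functor.map_id]
    · rw [← Category.comp_id f, ← h, ← Category.assoc, hY.2 n hn (f ≫ i), zero_comp]
  exists_tri X := by
    -- The outer pieces `u` in `U'` and `l` in `L` already lie in the glued halves. Only the middle
    -- piece `E` in `A` is decomposed, and two octahedra reassemble the triangle of `X`.
    obtain ⟨u, X₁, a, b, T, hu, hX₁⟩ := G.thin.cut'.exists_tri X
    obtain ⟨E, l, c, d, T', hE, hl⟩ := G.thin.cut.exists_tri X₁
    obtain ⟨K, R, k, q, TE, hK, hR⟩ := G.exists_tri_of_mem hA hc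
      ((hA E).2 ⟨hE, G.thin.dn_fiber T' hX₁ (G.thin.dn_le _ hl)⟩)
    obtain ⟨B, p, TB⟩ := exists_cone (k ≫ c)
    obtain ⟨x, y, Txy, -, -⟩ := TE.octahedron T' TB
    obtain ⟨K', k', TK'⟩ := exists_fiber (b ≫ p)
    obtain ⟨x', y', Txy', -, -⟩ := T.octahedron' TB TK'
    exact ⟨K', B, k', _, TK', G.up_ext Txy' (G.up_le _ hu) hK, G.dn_ext Txy hR (G.dn_le _ hl)⟩

end IsGlueDatum

end Gluing

/-! ### Orthogonality to objects of N under the shift. -/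

section Shift

variable {C : Type u} [Category.{v} C] [HasZeroObject C] [HasShift C ℤ] [Preadditive C]
  [∀ n : ℤ, (shiftFunctor C n).Additive] [Pretriangulated C] {N : ObjectProperty C}
  [N.IsTriangulated] {X : C}

lemma forall_hom_shift_iff {M₀ M₁ : ObjectProperty N.FullSubcategory}
    (hM : ∀ n, M₁ (n⟦(1 : ℤ)⟧) ↔ M₀ n) (hM₁ : ∀ {m n}, (m ≅ n) → M₁ m → M₁ n) :
    (∀ n, M₁ n → ∀ f : X⟦(1 : ℤ)⟧ ⟶ n.obj, f = 0) ↔ ∀ n, M₀ n → ∀ f : X ⟶ n.obj, f = 0 := by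
  constructor
  · intro h n hn f
    have := h _ ((hM n).2 hn) (f⟦(1 : ℤ)⟧' ≫ ((N.ι.commShiftIso (1 : ℤ)).app n).inv)
    rw [← cancel_mono ((N.ι.commShiftIso (1 : ℤ)).app n).hom, Category.assoc, Iso.inv_hom_id,
      Category.comp_id, zero_comp] at this
    exact (shiftFunctor C (1 : ℤ)).map_injective (this.trans (Functor.map_zero _ _ _).symm)
  · intro h n hn f
    let e : n.obj ≅ (n⟦(-1 : ℤ)⟧).obj⟦(1 : ℤ)⟧ :=
      N.ι.mapIso (shiftNegShift n (1 : ℤ)).symm ≪≫ (N.ι.commShiftIso (1 : ℤ)).app (n⟦(-1 : ℤ)⟧)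
    obtain ⟨g, hg⟩ := (shiftFunctor C (1 : ℤ)).map_surjective (f ≫ e.hom)
    rw [h _ ((hM _).1 (hM₁ (shiftNegShift n (1 : ℤ)).symm hn)) g, Functor.map_zero] at hg
    rw [← cancel_mono e.hom, ← hg, zero_comp]

lemma forall_shift_hom_iff {M₀ M₁ : ObjectProperty N.FullSubcategory}
    (hM : ∀ n, M₁ (n⟦(1 : ℤ)⟧) ↔ M₀ n) (hM₁ : ∀ {m n}, (m ≅ n) → M₁ m → M₁ n) :
    (∀ n, M₁ n → ∀ f : n.obj ⟶ X⟦(1 : ℤ)⟧, f = 0) ↔ ∀ n, M₀ n → ∀ f : n.obj ⟶ X, f = 0 := by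
  constructor
  · intro h n hn f
    have := h _ ((hM n).2 hn) (((N.ι.commShiftIso (1 : ℤ)).app n).hom ≫ f⟦(1 : ℤ)⟧')
    rw [← cancel_epi ((N.ι.commShiftIso (1 : ℤ)).app n).inv, Iso.inv_hom_id_assoc,
      comp_zero] at this
    replace this : f⟦(1 : ℤ)⟧' = 0 := this
    exact (shiftFunctor C (1 : ℤ)).map_injective (this.trans (Functor.map_zero _ _ _).symm)
  · intro h n hn f
    let e : n.obj ≅ (n⟦(-1 : ℤ)⟧).obj⟦(1 : ℤ)⟧ :=
      N.ι.mapIso (shiftNegShift n (1 : ℤ)).symm ≪≫ (N.ι.commShiftIso (1 : ℤ)).app (n⟦(-1 : ℤ)⟧)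
    obtain ⟨g, hg⟩ := (shiftFunctor C (1 : ℤ)).map_surjective (e.inv ≫ f)
    rw [h _ ((hM _).1 (hM₁ (shiftNegShift n (1 : ℤ)).symm hn)) g, Functor.map_zero] at hg
    rw [← cancel_epi e.inv, ← hg, comp_zero]

end Shift

/-! ### Gluing slicings: uniqueness, existence and openness. -/

section GlueSlicings

variable {C : Type u} [Category.{v} C] [HasZeroObject C] [HasShift C ℤ] [Preadditive C]
  [∀ n : ℤ, (shiftFunctor C n).Additive] [Pretriangulated C] [IsTriangulated C]
  {N : ObjectProperty C} [N.IsTriangulated]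
  {P : Slicing C} {PN QN : Slicing N.FullSubcategory} {PQ QQ : Slicing (VerdierQuotient N)}

lemma IsGluable.exists_pos (h : IsGluable (QN, QQ)) :
    ∃ (P : Slicing C) (ε : ℝ), P.IsLocallyFinite ∧ IsCompatible P QN QQ ∧ 0 < ε ∧ ε < 1 / 2 ∧
      P.HasLengthIntervals (2 * ε) := by
  obtain ⟨P, hP, η, hη, hl⟩ := h
  have h₁ : min η (1 / 2) ≤ η := min_le_left _ _
  have h₂ : min η (1 / 2) ≤ 1 / 2 := min_le_right _ _
  have h₃ : 0 < min η (1 / 2) := lt_min hη (by norm_num)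
  exact ⟨P, min η (1 / 2) / 2, ⟨η, hη, hl⟩, hP, by linarith, by linarith,
    hl.mono (by linarith) (by linarith) (by linarith)⟩

namespace IsCompatible

variable (h : IsCompatible P PN PQ)
include h

lemma up_obj {S : Set ℝ} (hS : IsUpperSet S) {n : N.FullSubcategory} :
    P.up S n.obj ↔ PN.up S n :=
  ⟨fun hn ψ hψ Y hY f => by
    ext
    exact hn ψ hψ _ ((h ψ).1 Y hY) f.hom,
    fun hn => Slicing.up_map N.ι (fun φ X => (h φ).1 X) hS hn⟩

lemma dn_obj {S : Set ℝ} (hS : IsUpperSet S) {n : N.FullSubcategory} :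
    P.dn S n.obj ↔ PN.dn S n :=
  ⟨fun hn ψ hψ Y hY f => by
    ext
    exact hn ψ hψ _ ((h ψ).1 Y hY) f.hom,
    fun hn => Slicing.dn_map N.ι (fun φ X => (h φ).1 X) hS hn⟩

lemma up_Q {S : Set ℝ} (hS : IsUpperSet S) {X : C} (hX : P.up S X) :
    PQ.up S (N.trW.Q.obj X) :=
  Slicing.up_map N.trW.Q (fun φ X => (h φ).2 X) hS hX

lemma dn_Q {S : Set ℝ} (hS : IsUpperSet S) {X : C} (hX : P.dn S X) :
    PQ.dn S (N.trW.Q.obj X) :=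
  Slicing.dn_map N.trW.Q (fun φ X => (h φ).2 X) hS hX

variable [N.IsStableUnderRetracts]

/-- Slicings of `N` and `C/N` which are close to a compatible pair give gluing data. -/
lemma isGlueDatum {S S' T : Set ℝ} (hS : IsUpperSet S) (hS' : IsUpperSet S') (hT : IsUpperSet T)
    (hle : S' ⊆ S) (hadd : ∀ x ∈ S, x + 1 ∈ S') (hN : QN.up T ≤ PN.up S)
    (hN' : PN.up S' ≤ QN.up T) (hQ : QQ.up T ≤ PQ.up S) (hQ' : PQ.up S' ≤ QQ.up T) :
    IsGlueDatum (P.up S) (P.dn S) (P.up S') (P.dn S') (QN.up T) (QN.dn T)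
      (QQ.up T) (QQ.dn T) where
  thin := P.isThin hS hS' hle hadd
  cutN := QN.isCut hT
  cutQ := QQ.isCut hT
  up_Q hX := hQ' _ (h.up_Q hS' hX)
  dn_Q hX := ((QQ.isCut hT).le_iff (PQ.isCut hS)).1 hQ _ (h.dn_Q hS hX)
  up_obj hn := (h.up_obj hS).2 (hN _ hn)
  dn_obj hn := (h.dn_obj hS').2 (((PN.isCut hS').le_iff (QN.isCut hT)).1 hN' _ hn)
  up_N hn := hN' _ ((h.up_obj hS').1 hn)
  dn_N hn := ((QN.isCut hT).le_iff (PN.isCut hS)).1 hN _ ((h.dn_obj hS).1 hn)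
  mem_of_up {X K R k q} T hX hK hR := by
    -- The image of `R` is in `dn S`, and as a cone of a map between objects of `up S` it is in `up
    -- S` as well; so it is zero.
    rw [← isZero_Q_obj_iff (N := N)]
    refine (PQ.isCut hS).isZero ?_ (h.dn_Q hS hR)
    exact (PQ.isThin hS hS subset_rfl fun x hx => hle (hadd x hx)).up_cone (T.map N.trW.Q)
      (h.up_Q hS hK) (hQ _ hX)
  mem_of_dn {X K R k q} T hX hK hR := by
    rw [← isZero_Q_obj_iff (N := N)]
    refine (PQ.isCut hS').isZero (h.up_Q hS' hK) ?_
    exact (PQ.isThin hS' hS' subset_rfl fun x hx => hadd x (hle hx)).dn_fiber (T.map N.trW.Q)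
      (((PQ.isCut hS').le_iff (QQ.isCut hT)).1 hQ' _ hX) (h.dn_Q hS' hR)

lemma isGlueDatum_self {S : Set ℝ} (hS : IsUpperSet S) (hadd : ∀ x ∈ S, x + 1 ∈ S) :
    IsGlueDatum (P.up S) (P.dn S) (P.up S) (P.dn S) (PN.up S) (PN.dn S) (PQ.up S) (PQ.dn S) :=
  h.isGlueDatum hS hS hS subset_rfl hadd le_rfl le_rfl le_rfl le_rfl

/-- With `S' = S = T` the sandwich of the gluing datum is an equality, so the phases of `P` are read
off from the pair alone. No chain condition is needed. -/
lemma sem_iff (φ : ℝ) (X : C) :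
    P.sem φ X ↔ glueUp (PQ.up (Set.Ici φ)) (PN.dn (Set.Ici φ)) X ∧
      glueDn (PQ.dn (Set.Ioi φ)) (PN.up (Set.Ioi φ)) X := by
  have G := h.isGlueDatum_self (isUpperSet_Ici φ) fun x hx => by
    simp only [Set.mem_Ici] at *; linarith
  have G' := h.isGlueDatum_self (isUpperSet_Ioi φ) fun x hx => by
    simp only [Set.mem_Ioi] at *; linarith
  rw [P.sem_iff]
  exact ⟨fun hX => ⟨G.up_le _ hX.1, G'.dn_le _ hX.2⟩, fun hX => ⟨G.le_up _ hX.1, G'.le_dn _ hX.2⟩⟩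

lemma unique {P' : Slicing C} (h' : IsCompatible P' PN PQ) : P = P' := by
  ext φ X
  rw [h.sem_iff, h'.sem_iff]

end IsCompatible

variable [N.IsStableUnderRetracts]

/-- The family of t-structures obtained by gluing slicings of `N` and `C/N`. -/
def glueUpFamily (QN : Slicing N.FullSubcategory) (QQ : Slicing (VerdierQuotient N)) (t : ℝ) :
    ObjectProperty C := glueUp (QQ.up (Set.Ioi t)) (QN.dn (Set.Ioi t))

/-- The family of t-structures obtained by gluing slicings of `N` and `C/N`. -/
def glueDnFamily (QN : Slicing N.FullSubcategory) (QQ : Slicing (VerdierQuotient N)) (t : ℝ) :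
    ObjectProperty C := glueDn (QQ.dn (Set.Ioi t)) (QN.up (Set.Ioi t))

lemma up_shift_Ioi {D : Type u'} [Category.{v'} D] [HasZeroObject D] [HasShift D ℤ] [Preadditive D]
    [∀ n : ℤ, (shiftFunctor D n).Additive] [Pretriangulated D] (R : Slicing D) (t : ℝ) (X : D) :
    R.up (Set.Ioi (t + 1)) (X⟦(1 : ℤ)⟧) ↔ R.up (Set.Ioi t) X := by
  rw [R.up_shift, Set.preimage_add_const_Ioi, add_sub_cancel_right]

lemma dn_shift_Ioi {D : Type u'} [Category.{v'} D] [HasZeroObject D] [HasShift D ℤ] [Preadditive D]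
    [∀ n : ℤ, (shiftFunctor D n).Additive] [Pretriangulated D] (R : Slicing D) (t : ℝ) (X : D) :
    R.dn (Set.Ioi (t + 1)) (X⟦(1 : ℤ)⟧) ↔ R.dn (Set.Ioi t) X := by
  rw [R.dn_shift, Set.preimage_add_const_Ioi, add_sub_cancel_right]

section Main

variable {ε : ℝ} (h : IsCompatible P PN PQ) (h₀ : 0 < ε) (h₁ : ε < 1 / 2)
  (hl : P.HasLengthIntervals (2 * ε)) (hN : edist PN QN < ENNReal.ofReal ε)
  (hQ : edist PQ QQ < ENNReal.ofReal ε)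

include h h₀ h₁ hN hQ

/-- The window `(t - ε, t + ε)` absorbs the displacement of both slicings, and `ε < 1 / 2` keeps its
length below 1. -/
lemma isGlueDatum_of_edist_lt (t : ℝ) :
    IsGlueDatum (P.up (Set.Ioi (t - ε))) (P.dn (Set.Ioi (t - ε))) (P.up (Set.Ici (t + ε)))
      (P.dn (Set.Ici (t + ε))) (QN.up (Set.Ioi t)) (QN.dn (Set.Ioi t)) (QQ.up (Set.Ioi t))
      (QQ.dn (Set.Ioi t)) := by
  refine h.isGlueDatum (isUpperSet_Ioi _) (isUpperSet_Ici _) (isUpperSet_Ioi _)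
    (fun x hx => ?_) (fun x hx => ?_) (fun X hX => ?_) (fun X hX => Slicing.up_of_edist_lt hN hX)
    (fun X hX => ?_) (fun X hX => Slicing.up_of_edist_lt hQ hX)
  · simp only [Set.mem_Ioi, Set.mem_Ici] at *; linarith
  · simp only [Set.mem_Ioi, Set.mem_Ici] at *; linarith
  · rw [edist_comm] at hN
    exact Slicing.up_of_edist_lt hN
      (QN.up_mono (by rw [sub_add_cancel]; exact Set.Ioi_subset_Ici_self) hX)
  · rw [edist_comm] at hQ
    exact Slicing.up_of_edist_lt hQ
      (QQ.up_mono (by rw [sub_add_cancel]; exact Set.Ioi_subset_Ici_self) hX)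

include hl

lemma isCutFamily : IsCutFamily (glueUpFamily QN QQ) (glueDnFamily QN QQ) where
  cut t := (isGlueDatum_of_edist_lt h h₀ h₁ hN hQ t).isCut
    (fun X => P.interval_Ioo_iff (t - ε) (t + ε) X)
    (hl.chainCond (by linarith) (by linarith) (by linarith))
  anti {s t} hst X hX := ⟨QQ.up_mono (Set.Ioi_subset_Ioi hst) hX.1, fun n hn =>
    hX.2 n (QN.dn_anti (Set.Ioi_subset_Ioi hst) hn)⟩
  up_shift t X := by
    have c := QQ.isCut (isUpperSet_Ioi (t + 1))
    refine and_congr (Iff.trans ⟨c.up_iso ((N.trW.Q.commShiftIso (1 : ℤ)).app X),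
      c.up_iso ((N.trW.Q.commShiftIso (1 : ℤ)).app X).symm⟩ (up_shift_Ioi QQ t _))
      (forall_hom_shift_iff (dn_shift_Ioi QN t) (QN.isCut (isUpperSet_Ioi (t + 1))).dn_iso)
  dn_shift t X := by
    have c := QQ.isCut (isUpperSet_Ioi (t + 1))
    refine and_congr (Iff.trans ⟨c.dn_iso ((N.trW.Q.commShiftIso (1 : ℤ)).app X),
      c.dn_iso ((N.trW.Q.commShiftIso (1 : ℤ)).app X).symm⟩ (dn_shift_Ioi QQ t _))
      (forall_shift_hom_iff (up_shift_Ioi QN t) (QN.isCut (isUpperSet_Ioi (t + 1))).up_iso)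
  right_continuous {t X} hX := by
    refine ⟨fun ψ hψ => ?_, fun n hn f => ?_⟩
    · obtain ⟨s, hs, hs'⟩ := exists_between (Set.mem_Ioi.1 hψ)
      exact (hX s hs).1 ψ hs'
    · by_cases hn₀ : IsZero n
      · exact (N.ι.map_isZero hn₀).eq_of_src _ _
      obtain ⟨s, hs, hs'⟩ := exists_between
        (Set.mem_Ioi.1 ((QN.up_iff_minPhase (isUpperSet_Ioi t) hn₀).1 hn))
      exact (hX s hs).2 n ((QN.up_iff_minPhase (isUpperSet_Ioi s) hn₀).2 hs') f
  bounded X := by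
    refine ⟨P.minPhase X - ε, P.maxPhase X + ε,
      (isGlueDatum_of_edist_lt h h₀ h₁ hN hQ _).up_le _ ?_,
      (isGlueDatum_of_edist_lt h h₀ h₁ hN hQ _).dn_le _ ?_⟩
    · by_cases hX : IsZero X
      · exact P.up_of_isZero _ hX
      · rw [P.up_iff_minPhase (isUpperSet_Ici _) hX, sub_add_cancel]
        exact Set.mem_Ici.2 le_rfl
    · by_cases hX : IsZero X
      · exact P.dn_of_isZero _ hX
      · rw [P.dn_iff_maxPhase (isUpperSet_Ioi _) hX, add_sub_cancel_right]
        exact Set.notMem_Ioi.2 le_rfl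

lemma isGluable_of_edist_lt : IsGluable (QN, QQ) := by
  have D := isCutFamily h h₀ h₁ hl hN hQ
  have G := isGlueDatum_of_edist_lt h h₀ h₁ hN hQ
  have key {s t : ℝ} {X : C} (hs : glueUpFamily QN QQ s X) (ht : glueDnFamily QN QQ t X) :
      P.interval (Set.Ioo (s - ε) (t + ε)) X :=
    (P.interval_Ioo_iff _ _ X).2 ⟨(G s).le_up _ hs, (G t).le_dn _ ht⟩
  -- A glued slab of width `δ` lies in an interval of `P` of length `δ + 2 * ε`. This must be at
  -- most 1 for thinness and at most `4 * ε` for the chain conditions of `P`.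
  let δ := min (1 - 2 * ε) (2 * ε)
  have hδ : 0 < δ := lt_min (by linarith) (by linarith)
  have hδ₁ : δ ≤ 1 - 2 * ε := min_le_left _ _
  have hδ₂ : δ ≤ 2 * ε := min_le_right _ _
  let Q := D.slicing hδ (by linarith) fun t =>
    (hl.chainCond (a := t - ε) (b := t + δ + ε) (by linarith) (by linarith)
      (by linarith)).mono fun X hX => key hX.1 hX.2
  refine ⟨Q, fun φ => ⟨fun n hn => ⟨fun t ht => ?_, ?_⟩, fun X hX => ?_⟩, δ / 2, by linarith, ?_⟩
  -- Objects of `N` vanish in the quotient, so only the conditions inside `N` remain.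
  · exact ⟨QQ.up_of_isZero _ (isZero_Q_obj_iff.2 n.2), fun m hm f => (G t).hom_eq_zero_of_N
      (QN.up_of_sem (isUpperSet_Ioi t) ht hn) hm f⟩
  · exact ⟨QQ.dn_of_isZero _ (isZero_Q_obj_iff.2 n.2), fun m hm f => (G φ).hom_eq_zero_of_N
      hm (QN.dn_of_sem (isUpperSet_Ioi φ) (lt_irrefl φ) hn) f⟩
  · refine (QQ.sem_iff φ _).2 ⟨fun ψ hψ => ?_, hX.2.1⟩
    obtain ⟨t, ht, ht'⟩ := exists_between (not_le.1 (show ¬ φ ≤ ψ from hψ))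
    exact (hX.1 t ht').1 ψ (not_lt.2 ht.le)
  · refine Slicing.hasLengthIntervals_of_chainCond (by linarith) (by linarith) fun φ =>
      (hl.chainCond (a := φ - δ / 2 - ε) (b := φ + δ / 2 + ε) (by linarith) (by linarith)
        (by linarith)).mono ?_
    rintro X ⟨F, hF⟩
    obtain ⟨l, hl, hl'⟩ := F.hasHN
    have hlm (ψ : ℝ) (hψ : ψ ∈ l) : ψ ∈ Set.Ioo (φ - δ / 2) (φ + δ / 2) := by
      obtain ⟨i, rfl⟩ := (hl' ψ).1 hψ
      exact hF i
    refine key ?_ ?_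
    · exact hl.induction (fun _ => (D.cut _).up_zero) (D.cut _).up_ext
        fun ψ hψ Y hY => hY.1 _ (hlm ψ hψ).1
    · exact hl.induction (fun _ => (D.cut _).dn_zero) (D.cut _).dn_ext
        fun ψ hψ Y hY => D.mono (hlm ψ hψ).2.le _ hY.2

end Main

end GlueSlicings

end SlicingGlue

theorem mainTheorem3 {C : Type*} [Category* C] [HasZeroObject C] [HasShift C ℤ]
    [Preadditive C] [∀ n : ℤ, (shiftFunctor C n).Additive] [Pretriangulated C] [IsTriangulated C]
    (N : ObjectProperty C) [N.IsTriangulated] [N.IsStableUnderRetracts] :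
    (∀ (QN : SlicingGlue.Slicing N.FullSubcategory)
        (QQ : SlicingGlue.Slicing (SlicingGlue.VerdierQuotient N)),
      SlicingGlue.IsGluable (QN, QQ) ↔
      ∃ (P : SlicingGlue.Slicing C) (PN : SlicingGlue.Slicing N.FullSubcategory)
        (PQ : SlicingGlue.Slicing (SlicingGlue.VerdierQuotient N)) (ε : ℝ),
        P.IsLocallyFinite ∧ SlicingGlue.IsCompatible P PN PQ ∧
        0 < ε ∧ ε < 1 / 2 ∧ P.HasLengthIntervals (2 * ε) ∧
        edist PN QN < ENNReal.ofReal ε ∧ edist PQ QQ < ENNReal.ofReal ε) ∧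
    (∀ (QN : SlicingGlue.Slicing N.FullSubcategory)
        (QQ : SlicingGlue.Slicing (SlicingGlue.VerdierQuotient N))
        (Q Q' : SlicingGlue.Slicing C),
      SlicingGlue.IsCompatible Q QN QQ → SlicingGlue.IsCompatible Q' QN QQ → Q = Q') ∧
    IsOpen {q : SlicingGlue.Slicing N.FullSubcategory ×
        SlicingGlue.Slicing (SlicingGlue.VerdierQuotient N) | SlicingGlue.IsGluable q} := by

  refine ⟨fun QN QQ => ⟨fun h => ?_, ?_⟩, fun QN QQ Q Q' h h' => h.unique h', ?_⟩
  · obtain ⟨P, ε, hP, hc, h₀, h₁, hl⟩ := h.exists_pos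
    exact ⟨P, QN, QQ, ε, hP, hc, h₀, h₁, hl, by simpa using h₀, by simpa using h₀⟩
  · rintro ⟨P, PN, PQ, ε, -, hc, h₀, h₁, hl, hN, hQ⟩
    exact SlicingGlue.isGluable_of_edist_lt hc h₀ h₁ hl hN hQ
  -- The slicing glued from the centre serves for every pair in the ball of radius `ε`.
  · rw [EMetric.isOpen_iff]
    rintro ⟨QN, QQ⟩ h
    obtain ⟨P, ε, hP, hc, h₀, h₁, hl⟩ := SlicingGlue.IsGluable.exists_pos h
    refine ⟨ENNReal.ofReal ε, by simpa using h₀, ?_⟩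
    rintro ⟨RN, RQ⟩ hR
    rw [Metric.mem_eball, edist_comm, Prod.edist_eq, max_lt_iff] at hR
    exact SlicingGlue.isGluable_of_edist_lt hc h₀ h₁ hl hR.1 hR.2
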